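/- **Setting.** Let $(Z,d_Z)$ be a compact connected metric space and let $c\ge 1$, $s>0$. A *tower of covers* $\mathfrak W$ of $Z$ with resolution $s$ consists of finite covers $\mathcal W_\varepsilon=\{W_\alpha\}_{\alpha\in A_\varepsilon}$ of $Z$ by path connected open sets, one for each $\varepsilon\ge s$, and of maps $w_{\varepsilon,\varepsilon'}:A_\varepsilon\to A_{\varepsilon'}$ for $s\le\varepsilon\le\varepsilon'$ with $W_\alpha\subseteq W_{w_{\varepsilon,\varepsilon'}(\alpha)}$, $w_{\varepsilon,\varepsilon}=\mathrm{id}$ and $w_{\varepsilon',\varepsilon''}\circ w_{\varepsilon,\varepsilon'}=w_{\varepsilon,\varepsilon''}$. It is *$(c,s)$-good* if $s\le\operatorname{diam}(Z)$; $\operatorname{diam}(W)\le\varepsilon$ for all $\varepsilon\ge s$ and $W\in\mathcal W_\varepsilon$; and every $O\subseteq Z$ with $\operatorname{diam}(O)\ge s$ is contained in some $W\in\mathcal W_{c\cdot\operatorname{diam}(O)}$. The tower $R_{\log}\mathfrak W$ has resolution $\log s$, and its cover at $t\ge\log s$ is $\mathcal W_{e^t}$. Let $K$ be a simplicial complex with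 vertex set $V$ and 1-skeleton graph $K_1$, let $f:|K|\to Z$ be continuous and let $f_V:V\to Z$ be its restriction to the vertices. The *pullback* $f^*(\mathcal W)$ is the family of the path components of the sets $f^{-1}(W_\alpha)$, indexed by pairs ($\alpha$, component); the *$K_1$-induced pullback* $f_V^{*_{K_1}}(\mathcal W)$ is the family of the vertex sets of the connected components of the subgraphs of $K_1$ induced on $f_V^{-1}(W_\alpha)$, indexed likewise. The maps $w_{\varepsilon,\varepsilon'}$ induce maps of these families. Taking nerves gives two towers of simplicial complexes and simplicial maps, the multiscale mapper $\mathrm{MM}(\mathfrak W,f)$ and the combinatorial multiscale mapper $\mathrm{MM}^{K_1}(\mathfrak W,f_V)$. Assume that all these pullback families are finite (for the first this holds if $f$ is well-behaved, i.e. preimages of path connected open sets have finitely many path components; for the second it holds if $K$ is finite). For a tower $\mathfrak S$ of simplicial complexes, $\mathrm D_k\mathfrak S$ denotes the persistence diagram of the persistence module obtained by applying $H_k(\,\cdot\,;F)$, $F$ a fixed field, extended by zero below the resolution of the tower; it is a multiset of points $(a,b)$ with $a<b\le\infty$. The bottleneck distance is taken in the $\ell^\infty$-metric: it is the infimum, over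 all partial matchings of the two multisets, of the largest distance between matched points or between an unmatched point and the diagonal, where points with $b=\infty$ are at infinite distance from the diagonal and from points with finite $b$. **Theorem.** Let $\mathfrak W$ be a $(c,s)$-good tower of covers of $Z$ such that the *minimum diameter condition* holds: for every simplex $\sigma$ of $K$, $$\operatorname{diam}(f(\sigma))\le\inf\{\operatorname{diam}(W): W\in\mathcal W_\varepsilon,\ \varepsilon\ge s\}.$$ Then for every $k\ge 0$ the bottleneck distance between $\mathrm D_k\,\mathrm{MM}(R_{\log}\mathfrak W,f)$ and $\mathrm D_k\,\mathrm{MM}^{K_1}(R_{\log}\mathfrak W,f_V)$ is at most $$3\log(3c)+3\max\bigl(0,\log\tfrac1s\bigr).$$ -/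

import Mathlib

open scoped ENNReal

/-! ## Geometric realization and 1-skeleton of a simplicial complex -/

namespace AbstractSimplicialComplex

/-- The underlying space `|K|` in barycentric coordinates: finitely supported functions on the
vertex set, with nonnegative values of sum `1`, whose support is a simplex of `K`. -/
def Realization {V : Type*} (K : AbstractSimplicialComplex V) : Type _ :=
  {x : V →₀ ℝ // (∀ v, 0 ≤ x v) ∧ (x.sum fun _ a => a) = 1 ∧ x.support ∈ K.faces}

/-- The closed simplex `|σ| ⊆ |K|` spanned by a set `σ` of vertices. -/
def closedSimplex {V : Type*} (K : AbstractSimplicialComplex V) (σ : Finset V) :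
    Set K.Realization :=
  {x | x.1.support ⊆ σ}

open Classical in
/-- The inclusion `|σ| → |K|` of the standard simplex with vertex set a simplex `σ` of `K`, which
extends barycentric coordinates by zero. -/
noncomputable def simplexInclusion {V : Type*} (K : AbstractSimplicialComplex V) (σ : K.faces)
    (x : stdSimplex ℝ {v // v ∈ σ.1}) : K.Realization :=
  ⟨Finsupp.onFinset σ.1 (fun v => if h : v ∈ σ.1 then x.1 ⟨v, h⟩ else 0)
      (fun v hv => by by_contra h; exact hv (dif_neg h)), by
    have hsum : ((Finsupp.onFinset σ.1 (fun v => if h : v ∈ σ.1 then x.1 ⟨v, h⟩ else 0)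
        (fun v hv => by by_contra h; exact hv (dif_neg h))).sum fun _ a => a) = 1 := by
      rw [Finsupp.onFinset_sum _ (fun _ => rfl), ← Finset.sum_coe_sort, ← x.2.2]
      exact Finset.sum_congr rfl fun v _ => dif_pos v.2
    refine ⟨fun v => ?_, hsum, (K.isRelLowerSet_faces σ.2).2 Finsupp.support_onFinset_subset ?_⟩
    · rw [Finsupp.onFinset_apply]
      split_ifs with h
      · exact x.2.1 _
      · exact le_rfl
    · rw [Finset.nonempty_iff_ne_empty]
      intro h
      rw [Finsupp.sum, h, Finset.sum_empty] at hsum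
      exact zero_ne_one hsum⟩

/-- The usual (coherent) topology of `|K|`: the final topology with respect to the inclusions
`|σ| → |K|` of the standard simplices. -/
noncomputable instance {V : Type*} (K : AbstractSimplicialComplex V) : TopologicalSpace K.Realization :=
  ⨆ σ : K.faces, TopologicalSpace.coinduced (K.simplexInclusion σ) inferInstance

/-- The point of `|K|` given by a vertex of `K`. -/
noncomputable def vertexPoint {V : Type*} (K : AbstractSimplicialComplex V) (v : V) :
    K.Realization :=
  ⟨Finsupp.single v 1, by
    refine ⟨fun w => ?_, by simp, ?_⟩
    · classical
      rw [Finsupp.single_apply]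
      split_ifs <;> norm_num
    · rw [Finsupp.support_single v one_ne_zero]
      exact K.singleton_mem v⟩

open Classical in
/-- The 1-skeleton `K_1` of `K`, as a graph on the vertices of `K`. -/
def oneSkeletonGraph {V : Type*} (K : AbstractSimplicialComplex V) : SimpleGraph V where
  Adj u v := u ≠ v ∧ ({u, v} : Finset V) ∈ K.faces
  symm := ⟨fun u v h => ⟨h.1.symm, by rw [Finset.pair_comm]; exact h.2⟩⟩
  loopless := ⟨fun _ h => h.1 rfl⟩

end AbstractSimplicialComplex

namespace MultiscaleMapper

/-! ## Towers of covers -/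

/-- A tower with resolution `r` of indexed families of subsets of `X`, with maps of families
`w_{ε,ε'}` for `r ≤ ε ≤ ε'` that send each set to a set containing it and that are functorial. -/
structure SetTower.{u, v} (X : Type v) (r : ℝ) where
  /-- the index set of the family at scale `ε` -/
  Idx : Set.Ici r → Type u
  /-- the members of the family at scale `ε` -/
  carrier : ∀ ε, Idx ε → Set X
  /-- the map from the family at scale `ε` to the family at scale `ε'` -/
  map : ∀ {ε ε' : Set.Ici r}, ε ≤ ε' → Idx ε → Idx ε'
  subset_map : ∀ {ε ε' : Set.Ici r} (h : ε ≤ ε') (α : Idx ε),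
    carrier ε α ⊆ carrier ε' (map h α)
  map_refl : ∀ (ε : Set.Ici r) (α : Idx ε), map (le_refl ε) α = α
  map_map : ∀ {ε ε' ε'' : Set.Ici r} (h : ε ≤ ε') (h' : ε' ≤ ε'') (α : Idx ε),
    map h' (map h α) = map (h.trans h') α

/-- All families of the tower are finite. -/
def SetTower.IsFinite {X : Type*} {r : ℝ} (W : SetTower X r) : Prop :=
  ∀ ε, Finite (W.Idx ε)

/-- A tower of finite covers of `X` by path connected open sets. -/
structure SetTower.IsCoverTower {X : Type*} [TopologicalSpace X] {r : ℝ} (W : SetTower X r) :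
    Prop where
  finite : W.IsFinite
  isOpen : ∀ ε α, IsOpen (W.carrier ε α)
  isPathConnected : ∀ ε α, IsPathConnected (W.carrier ε α)
  cover : ∀ ε, ⋃ α, W.carrier ε α = Set.univ

/-- `W` is a `(c, s)`-good tower of covers of `Z`; its resolution is `s`. -/
structure SetTower.IsGood {Z : Type*} [MetricSpace Z] {s : ℝ} (W : SetTower Z s) (c : ℝ) :
    Prop extends W.IsCoverTower where
  one_le : 1 ≤ c
  pos : 0 < s
  le_diam : s ≤ Metric.diam (Set.univ : Set Z)
  diam_le : ∀ (ε : Set.Ici s) (α : W.Idx ε), Metric.diam (W.carrier ε α) ≤ ε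
  exists_superset : ∀ O : Set Z, s ≤ Metric.diam O →
    ∀ ε : Set.Ici s, (ε : ℝ) = c * Metric.diam O → ∃ α : W.Idx ε, O ⊆ W.carrier ε α

/-- `κ(W)`, the infimum of the diameters of all members of all covers of the tower. -/
noncomputable def SetTower.minDiam {Z : Type*} [MetricSpace Z] {r : ℝ} (W : SetTower Z r) : ℝ :=
  ⨅ p : Σ ε : Set.Ici r, W.Idx ε, Metric.diam (W.carrier p.1 p.2)

/-- The minimum diameter condition: `diam f(σ) ≤ κ(W)` for every simplex `σ` of `K`. -/
def MinimumDiameterCondition {V Z : Type*} [MetricSpace Z] {r : ℝ}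
    (K : AbstractSimplicialComplex V) (f : K.Realization → Z) (W : SetTower Z r) : Prop :=
  ∀ σ ∈ K.faces, Metric.diam (f '' K.closedSimplex σ) ≤ W.minDiam

/-- The reindexed tower `R_log W`: its family at scale `t ≥ log r` is that of `W` at `exp t`. -/
noncomputable def SetTower.reindexLog {X : Type*} {r : ℝ} (W : SetTower X r) (hr : 0 < r) :
    SetTower X (Real.log r) :=
  let e : Set.Ici (Real.log r) → Set.Ici r := fun t => ⟨Real.exp t, (Real.log_le_iff_le_exp hr).1 t.2⟩
  { Idx := fun t => W.Idx (e t)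
    carrier := fun t => W.carrier (e t)
    map := fun {t t'} h => W.map (show e t ≤ e t' from Real.exp_le_exp.2 h)
    subset_map := fun _ α => W.subset_map _ α
    map_refl := fun _ α => W.map_refl _ α
    map_map := fun _ _ α => W.map_map _ _ α }

/-! ## Pullbacks -/

/-- The path component of `T` that contains a given path component of a subset `S ⊆ T`. -/
def inclPathComponent {X : Type*} [TopologicalSpace X] {S T : Set X} (h : S ⊆ T) :
    ZerothHomotopy S → ZerothHomotopy T :=
  ZerothHomotopy.lift (fun x => ZerothHomotopy.mk (Set.inclusion h x))
    fun _ _ p => ZerothHomotopy.sound (p.map (continuous_inclusion h))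

/-- The pullback tower `f^*(W)`: at scale `ε` it consists of the path components of the
preimages `f⁻¹(W_α)`. -/
def SetTower.pullback {X Z : Type*} [TopologicalSpace X] {r : ℝ} (W : SetTower Z r) (f : X → Z) :
    SetTower X r where
  Idx ε := Σ α : W.Idx ε, ZerothHomotopy (f ⁻¹' W.carrier ε α)
  carrier ε p := {x | ∃ h : x ∈ f ⁻¹' W.carrier ε p.1, ZerothHomotopy.mk ⟨x, h⟩ = p.2}
  map h p := ⟨W.map h p.1, inclPathComponent (Set.preimage_mono (W.subset_map h p.1)) p.2⟩
  subset_map h p := by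
    rintro x ⟨hx, hp⟩
    exact ⟨W.subset_map h p.1 hx, by rw [← hp]; rfl⟩
  map_refl ε := by
    rintro ⟨α, C⟩
    obtain ⟨⟨x, hx⟩, rfl⟩ := ZerothHomotopy.mk_surjective C
    have key : ∀ (β : W.Idx ε) (_ : β = α) (hβ : x ∈ f ⁻¹' W.carrier ε β),
        (⟨β, ZerothHomotopy.mk ⟨x, hβ⟩⟩ : Σ α : W.Idx ε, ZerothHomotopy (f ⁻¹' W.carrier ε α)) =
          ⟨α, ZerothHomotopy.mk ⟨x, hx⟩⟩ := by
      rintro _ rfl _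
      rfl
    exact key _ (W.map_refl ε α) (W.subset_map _ α hx)
  map_map {ε ε' ε''} h h' := by
    rintro ⟨α, C⟩
    obtain ⟨⟨x, hx⟩, rfl⟩ := ZerothHomotopy.mk_surjective C
    have key : ∀ (β γ : W.Idx ε'') (_ : β = γ) (hβ : x ∈ f ⁻¹' W.carrier ε'' β)
        (hγ : x ∈ f ⁻¹' W.carrier ε'' γ),
        (⟨β, ZerothHomotopy.mk ⟨x, hβ⟩⟩ :
          Σ α : W.Idx ε'', ZerothHomotopy (f ⁻¹' W.carrier ε'' α)) =
          ⟨γ, ZerothHomotopy.mk ⟨x, hγ⟩⟩ := by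
      rintro _ _ rfl _ _
      rfl
    exact key _ _ (W.map_map h h' α) (W.subset_map h' _ (W.subset_map h α hx))
      (W.subset_map _ α hx)

/-- The `G`-induced pullback tower `f^{*_G}(W)` for a map `f` on the vertices of a graph `G`: at
scale `ε` it consists of the vertex sets of the connected components of the subgraphs of `G`
induced on the sets `f⁻¹(W_α)`. -/
def SetTower.graphPullback {V Z : Type*} {r : ℝ} (W : SetTower Z r) (G : SimpleGraph V)
    (f : V → Z) : SetTower V r where
  Idx ε := Σ α : W.Idx ε, (G.induce (f ⁻¹' W.carrier ε α)).ConnectedComponent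
  carrier ε p :=
    {v | ∃ h : v ∈ f ⁻¹' W.carrier ε p.1,
      (G.induce (f ⁻¹' W.carrier ε p.1)).connectedComponentMk ⟨v, h⟩ = p.2}
  map h p := ⟨W.map h p.1, p.2.map
    (G.induceHomOfLE (Set.preimage_mono (W.subset_map h p.1))).toHom⟩
  subset_map h p := by
    rintro x ⟨hx, hp⟩
    exact ⟨W.subset_map h p.1 hx, by rw [← hp]; rfl⟩
  map_refl ε := by
    rintro ⟨α, C⟩
    induction C using SimpleGraph.ConnectedComponent.ind with | _ v =>
    obtain ⟨x, hx⟩ := v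
    have key : ∀ (β : W.Idx ε) (_ : β = α) (hβ : x ∈ f ⁻¹' W.carrier ε β),
        (⟨β, (G.induce (f ⁻¹' W.carrier ε β)).connectedComponentMk ⟨x, hβ⟩⟩ :
          Σ α : W.Idx ε, (G.induce (f ⁻¹' W.carrier ε α)).ConnectedComponent) =
          ⟨α, (G.induce (f ⁻¹' W.carrier ε α)).connectedComponentMk ⟨x, hx⟩⟩ := by
      rintro _ rfl _
      rfl
    exact key _ (W.map_refl ε α) (W.subset_map _ α hx)
  map_map {ε ε' ε''} h h' := by
    rintro ⟨α, C⟩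
    induction C using SimpleGraph.ConnectedComponent.ind with | _ v =>
    obtain ⟨x, hx⟩ := v
    have key : ∀ (β γ : W.Idx ε'') (_ : β = γ) (hβ : x ∈ f ⁻¹' W.carrier ε'' β)
        (hγ : x ∈ f ⁻¹' W.carrier ε'' γ),
        (⟨β, (G.induce (f ⁻¹' W.carrier ε'' β)).connectedComponentMk ⟨x, hβ⟩⟩ :
          Σ α : W.Idx ε'', (G.induce (f ⁻¹' W.carrier ε'' α)).ConnectedComponent) =
          ⟨γ, (G.induce (f ⁻¹' W.carrier ε'' γ)).connectedComponentMk ⟨x, hγ⟩⟩ := by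
      rintro _ _ rfl _ _
      rfl
    exact key _ _ (W.map_map h h' α) (W.subset_map h' _ (W.subset_map h α hx))
      (W.subset_map _ α hx)

/-! ## Nerves and towers of simplicial complexes -/

open Classical in
/-- The vertex map `φ` is a simplicial map from `K` to `L`. -/
def IsSimplicialMap {A B : Type*} (K : PreAbstractSimplicialComplex A)
    (L : PreAbstractSimplicialComplex B) (φ : A → B) : Prop :=
  ∀ σ ∈ K.faces, σ.image φ ∈ L.faces

/-- The nerve of a family of sets. -/
def nerve {A X : Type*} (U : A → Set X) : PreAbstractSimplicialComplex A where
  faces := {σ | σ.Nonempty ∧ (⋂ α ∈ σ, U α).Nonempty}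
  isRelLowerSet_faces := by
    rintro σ ⟨hσ, x, hx⟩
    refine ⟨hσ, fun τ hτ hne => ⟨hne, x, ?_⟩⟩
    simp only [Set.mem_iInter] at hx ⊢
    exact fun α hα => hx α (hτ hα)

/-- A tower of simplicial complexes and simplicial maps, with resolution `r`. -/
structure SimplicialTower.{u} (r : ℝ) where
  /-- the type of (possible) vertices at scale `ε` -/
  Vert : Set.Ici r → Type u
  /-- the simplicial complex at scale `ε` -/
  cplx : ∀ ε, PreAbstractSimplicialComplex (Vert ε)
  /-- the simplicial map from scale `ε` to scale `ε'`, on vertices -/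
  map : ∀ {ε ε' : Set.Ici r}, ε ≤ ε' → Vert ε → Vert ε'
  isSimplicialMap : ∀ {ε ε' : Set.Ici r} (h : ε ≤ ε'),
    IsSimplicialMap (cplx ε) (cplx ε') (map h)
  map_refl : ∀ (ε : Set.Ici r) (α : Vert ε), map (le_refl ε) α = α
  map_map : ∀ {ε ε' ε'' : Set.Ici r} (h : ε ≤ ε') (h' : ε' ≤ ε'') (α : Vert ε),
    map h' (map h α) = map (h.trans h') α

/-- The tower of nerves of a tower of families of sets. -/
def SetTower.nerveTower {X : Type*} {r : ℝ} (W : SetTower X r) : SimplicialTower r where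
  Vert := W.Idx
  cplx ε := nerve (W.carrier ε)
  map h := W.map h
  isSimplicialMap h := by
    classical
    rintro σ ⟨hσ, x, hx⟩
    refine ⟨?_, x, ?_⟩
    · simpa using hσ
    · simp only [Set.mem_iInter, Finset.mem_image] at hx ⊢
      rintro _ ⟨α, hα, rfl⟩
      exact W.subset_map h α (hx α hα)
  map_refl := W.map_refl
  map_map h h' := W.map_map h h'

/-- The multiscale mapper `MM(W, f) = N(f^*(W))`. -/
def multiscaleMapper {X Z : Type*} [TopologicalSpace X] {r : ℝ} (W : SetTower Z r) (f : X → Z) :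
    SimplicialTower r :=
  (W.pullback f).nerveTower

/-- The `G`-induced multiscale mapper `MM^G(W, f) = N(f^{*_G}(W))`. -/
def graphMultiscaleMapper {V Z : Type*} {r : ℝ} (W : SetTower Z r) (G : SimpleGraph V)
    (f : V → Z) : SimplicialTower r :=
  (W.graphPullback G f).nerveTower

/-! ## Simplicial homology, by ordered chains -/

section Homology

open Classical in
/-- Ordered `n`-simplices of `K`: tuples `(a₀, …, aₙ)` of vertices, repetitions allowed, whose
underlying set is a simplex of `K`. -/
def OrderedSimplex {A : Type*} (K : PreAbstractSimplicialComplex A) (n : ℕ) : Type _ :=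
  {t : Fin (n + 1) → A // Finset.univ.image t ∈ K.faces}

/-- The `i`-th face, which omits the `i`-th vertex. -/
def OrderedSimplex.face {A : Type*} {K : PreAbstractSimplicialComplex A} {n : ℕ}
    (t : OrderedSimplex K (n + 1)) (i : Fin (n + 2)) : OrderedSimplex K n :=
  ⟨fun j => t.1 (i.succAbove j), by
    classical
    refine (K.isRelLowerSet_faces t.2).2 ?_ (Finset.univ_nonempty.image _)
    intro a ha
    simp only [Finset.mem_image, Finset.mem_univ, true_and] at ha ⊢
    obtain ⟨j, rfl⟩ := ha
    exact ⟨_, rfl⟩⟩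

/-- The image of an ordered simplex under a simplicial map. -/
def OrderedSimplex.map {A B : Type*} {K : PreAbstractSimplicialComplex A}
    {L : PreAbstractSimplicialComplex B} {φ : A → B} (hφ : IsSimplicialMap K L φ) {n : ℕ}
    (t : OrderedSimplex K n) : OrderedSimplex L n :=
  ⟨fun j => φ (t.1 j), by
    classical
    have h := hφ _ t.2
    rw [Finset.image_image] at h
    exact h⟩

variable (F : Type*) [Field F]

/-- The space of ordered `n`-chains of `K` with coefficients in `F`. -/
abbrev Chain {A : Type*} (K : PreAbstractSimplicialComplex A) (n : ℕ) : Type _ :=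
  OrderedSimplex K n →₀ F

/-- The boundary map `(a₀, …, aₙ₊₁) ↦ ∑ᵢ (-1)ⁱ (a₀, …, âᵢ, …, aₙ₊₁)`. -/
noncomputable def boundary {A : Type*} (K : PreAbstractSimplicialComplex A) (n : ℕ) :
    Chain F K (n + 1) →ₗ[F] Chain F K n :=
  Finsupp.linearCombination F fun t : OrderedSimplex K (n + 1) =>
    ∑ i : Fin (n + 2), Finsupp.single (t.face i) ((-1 : F) ^ (i : ℕ))

/-- The space of `n`-cycles; every `0`-chain is a cycle. -/
noncomputable def cycles {A : Type*} (K : PreAbstractSimplicialComplex A) :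
    (n : ℕ) → Submodule F (Chain F K n)
  | 0 => ⊤
  | n + 1 => LinearMap.ker (boundary F K n)

variable {F} in
/-- The quotient `Z / B` for submodules `B ≤ Z` of a vector space. -/
abbrev Subquotient {M : Type*} [AddCommGroup M] [Module F M] (Z B : Submodule F M) : Type _ :=
  Z ⧸ B.submoduleOf Z

variable {F} in
/-- The map `Z / B → Z' / B'` induced by a linear map. -/
def subquotientMap {M N : Type*} [AddCommGroup M] [Module F M] [AddCommGroup N] [Module F N]
    {Z B : Submodule F M} {Z' B' : Submodule F N} (g : M →ₗ[F] N)
    (hZ : ∀ x ∈ Z, g x ∈ Z') (hB : ∀ x ∈ B, g x ∈ B') :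
    Subquotient Z B →ₗ[F] Subquotient Z' B' :=
  Submodule.mapQ _ _ (g.restrict hZ) fun x hx => hB x.1 hx

/-- The `n`-th simplicial homology of `K`: cycles modulo boundaries. -/
abbrev Homology {A : Type*} (K : PreAbstractSimplicialComplex A) (n : ℕ) : Type _ :=
  Subquotient (cycles F K n) (LinearMap.range (boundary F K n))

variable {F}

/-- The chain map induced by a simplicial map. -/
noncomputable def chainMap {A B : Type*} {K : PreAbstractSimplicialComplex A}
    {L : PreAbstractSimplicialComplex B} {φ : A → B} (hφ : IsSimplicialMap K L φ) (n : ℕ) :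
    Chain F K n →ₗ[F] Chain F L n :=
  Finsupp.lmapDomain F F (OrderedSimplex.map hφ)

theorem boundary_chainMap {A B : Type*} {K : PreAbstractSimplicialComplex A}
    {L : PreAbstractSimplicialComplex B} {φ : A → B} (hφ : IsSimplicialMap K L φ) (n : ℕ)
    (x : Chain F K (n + 1)) :
    boundary F L n (chainMap hφ (n + 1) x) = chainMap hφ n (boundary F K n x) := by
  induction x using Finsupp.induction_linear with
  | zero => simp
  | add x y hx hy => simp only [map_add, hx, hy]
  | single t a =>
    simp only [boundary, chainMap, Finsupp.lmapDomain_apply, Finsupp.mapDomain_single,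
      Finsupp.linearCombination_single, map_smul, map_sum]
    rfl

theorem chainMap_mem_cycles {A B : Type*} {K : PreAbstractSimplicialComplex A}
    {L : PreAbstractSimplicialComplex B} {φ : A → B} (hφ : IsSimplicialMap K L φ) (n : ℕ)
    (x : Chain F K n) (hx : x ∈ cycles F K n) : chainMap hφ n x ∈ cycles F L n := by
  cases n with
  | zero => trivial
  | succ n =>
    change boundary F K n x = 0 at hx
    change boundary F L n _ = 0
    rw [boundary_chainMap, hx, map_zero]

theorem chainMap_mem_range {A B : Type*} {K : PreAbstractSimplicialComplex A}
    {L : PreAbstractSimplicialComplex B} {φ : A → B} (hφ : IsSimplicialMap K L φ) (n : ℕ)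
    (x : Chain F K n) (hx : x ∈ LinearMap.range (boundary F K n)) :
    chainMap hφ n x ∈ LinearMap.range (boundary F L n) := by
  obtain ⟨y, rfl⟩ := hx
  exact ⟨chainMap hφ (n + 1) y, boundary_chainMap hφ n y⟩

/-- The map on homology induced by a simplicial map. -/
noncomputable def homologyMap {A B : Type*} {K : PreAbstractSimplicialComplex A}
    {L : PreAbstractSimplicialComplex B} {φ : A → B} (hφ : IsSimplicialMap K L φ) (n : ℕ) :
    Homology F K n →ₗ[F] Homology F L n :=
  subquotientMap (chainMap hφ n) (chainMap_mem_cycles hφ n) (chainMap_mem_range hφ n)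

theorem homologyMap_id {A : Type*} {K : PreAbstractSimplicialComplex A} {φ : A → A}
    (hφ : IsSimplicialMap K K φ) (h : ∀ a, φ a = a) (n : ℕ) :
    homologyMap (F := F) hφ n = LinearMap.id := by
  refine LinearMap.ext fun x => ?_
  obtain ⟨x, rfl⟩ := Submodule.Quotient.mk_surjective _ x
  refine congrArg Submodule.Quotient.mk (Subtype.ext ?_)
  change Finsupp.mapDomain (OrderedSimplex.map hφ) x.1 = x.1
  have : OrderedSimplex.map hφ (n := n) = id :=
    funext fun t => Subtype.ext (funext fun j => h _)
  rw [this, Finsupp.mapDomain_id]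

theorem homologyMap_comp {A B C : Type*} {K : PreAbstractSimplicialComplex A}
    {L : PreAbstractSimplicialComplex B} {M : PreAbstractSimplicialComplex C} {φ : A → B}
    {ψ : B → C} {χ : A → C} (hφ : IsSimplicialMap K L φ) (hψ : IsSimplicialMap L M ψ)
    (hχ : IsSimplicialMap K M χ) (h : ∀ a, ψ (φ a) = χ a) (n : ℕ) :
    homologyMap (F := F) hψ n ∘ₗ homologyMap hφ n = homologyMap hχ n := by
  refine LinearMap.ext fun x => ?_
  obtain ⟨x, rfl⟩ := Submodule.Quotient.mk_surjective _ x
  refine congrArg Submodule.Quotient.mk (Subtype.ext ?_)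
  change Finsupp.mapDomain (OrderedSimplex.map hψ) (Finsupp.mapDomain (OrderedSimplex.map hφ) x.1)
    = Finsupp.mapDomain (OrderedSimplex.map hχ) x.1
  have : OrderedSimplex.map hψ (n := n) ∘ OrderedSimplex.map hφ = OrderedSimplex.map hχ :=
    funext fun t => Subtype.ext (funext fun j => h _)
  rw [← Finsupp.mapDomain_comp, this]

end Homology

/-! ## Persistence modules, persistence diagrams and the bottleneck distance -/

/-- The persistence module obtained from a tower of simplicial complexes by applying the `k`-th
simplicial homology with coefficients in `F`. -/
noncomputable def SimplicialTower.homology {r : ℝ} (S : SimplicialTower r) (F : Type*) [Field F]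
    (k : ℕ) : CategoryTheory.Functor (Set.Ici r) (ModuleCat F) where
  obj ε := ModuleCat.of F (Homology F (S.cplx ε) k)
  map h := ModuleCat.ofHom (homologyMap (S.isSimplicialMap (CategoryTheory.leOfHom h)) k)
  map_id ε := by
    ext1
    exact homologyMap_id _ (S.map_refl ε) k
  map_comp h h' := by
    ext1
    exact (homologyMap_comp _ _ _ (S.map_map (CategoryTheory.leOfHom h)
      (CategoryTheory.leOfHom h')) k).symm

open Classical in
/-- The rank of the structure map `M_a → M_b` of a persistence module with resolution `r`;
the module is extended by zero to the scales below `r`. -/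
noncomputable def rank {F : Type*} [Field F] {r : ℝ}
    (M : CategoryTheory.Functor (Set.Ici r) (ModuleCat F)) (a b : ℝ) : ℕ :=
  if h : r ≤ a ∧ a ≤ b then
    Module.finrank F (LinearMap.range (M.map (CategoryTheory.homOfLE
      (show (⟨a, h.1⟩ : Set.Ici r) ≤ ⟨b, h.1.trans h.2⟩ from h.2))).hom)
  else 0

/-- A persistence diagram: a multiset of points `(birth, death)` in `ℝ × (ℝ ∪ {∞})`, off the
diagonal, given by its multiplicity function. -/
abbrev PersistenceDiagram : Type := ℝ × WithTop ℝ → ℕ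

/-- The persistence diagram of a persistence module (with finite ranks). For `a < b < ∞`, the
multiplicity of `(a, b)` is the eventual value, as `δ` decreases to `0`, of the number
`rank (a+δ) (b-δ) - rank (a+δ) (b+δ) - rank (a-δ) (b-δ) + rank (a-δ) (b+δ)` of classes that are
born in `(a-δ, a+δ]` and die in `(b-δ, b+δ]`; the multiplicity of `(a, ∞)` is the eventual value,
as `δ` decreases to `0` and `B` increases to `∞`, of the number `rank (a+δ) B - rank (a-δ) B` of
classes that are born in `(a-δ, a+δ]` and still alive at `B`. These numbers are nonnegative and
decrease with the rectangle, so that the eventual value is the minimum. Points `(a, b)` with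
`b ≤ a` have multiplicity `0`. -/
noncomputable def diagram {F : Type*} [Field F] {r : ℝ}
    (M : CategoryTheory.Functor (Set.Ici r) (ModuleCat F)) : PersistenceDiagram
  | (a, (b : ℝ)) => sInf {n : ℕ | ∃ δ : ℝ, 0 < δ ∧ a + δ < b - δ ∧
      (n : ℤ) = (rank M (a + δ) (b - δ) : ℤ) - rank M (a + δ) (b + δ)
        - rank M (a - δ) (b - δ) + rank M (a - δ) (b + δ)}
  | (a, ⊤) => sInf {n : ℕ | ∃ δ B : ℝ, 0 < δ ∧ a + δ < B ∧
      (n : ℤ) = (rank M (a + δ) B : ℤ) - rank M (a - δ) B}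

/-- The points of a persistence diagram, counted with multiplicity. -/
def PersistenceDiagram.Point (D : PersistenceDiagram) : Type :=
  Σ p : ℝ × WithTop ℝ, Fin (D p)

/-- The `ℓ^∞`-distance between two points of the extended plane, with `|∞ - ∞| = 0`. -/
noncomputable def pointDist : ℝ × WithTop ℝ → ℝ × WithTop ℝ → ℝ≥0∞
  | (a, (b : ℝ)), (a', (b' : ℝ)) => max (edist a a') (edist b b')
  | (a, ⊤), (a', ⊤) => edist a a'
  | _, _ => ⊤

/-- The `ℓ^∞`-distance of a point to the diagonal. -/
noncomputable def diagonalDist : ℝ × WithTop ℝ → ℝ≥0∞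
  | (a, (b : ℝ)) => ENNReal.ofReal ((b - a) / 2)
  | (_, ⊤) => ⊤

/-- A partial matching between two multisets of points. -/
structure IsPartialMatching {D E : PersistenceDiagram} (m : Set (D.Point × E.Point)) : Prop where
  left_unique : ∀ p p' q, (p, q) ∈ m → (p', q) ∈ m → p = p'
  right_unique : ∀ p q q', (p, q) ∈ m → (p, q') ∈ m → q = q'

/-- The cost of a partial matching: the largest distance between matched points, or between an
unmatched point and the diagonal. -/
noncomputable def matchingCost {D E : PersistenceDiagram} (m : Set (D.Point × E.Point)) : ℝ≥0∞ :=
  (⨆ x ∈ m, pointDist x.1.1 x.2.1) ⊔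
    (⨆ (p : D.Point) (_ : ∀ q, (p, q) ∉ m), diagonalDist p.1) ⊔
    (⨆ (q : E.Point) (_ : ∀ p, (p, q) ∉ m), diagonalDist q.1)

/-- The bottleneck distance between two persistence diagrams. -/
noncomputable def bottleneckDist (D E : PersistenceDiagram) : ℝ≥0∞ :=
  ⨅ (m : Set (D.Point × E.Point)) (_ : IsPartialMatching m), matchingCost m

end MultiscaleMapper

/-! The geometric input is `exists_star_subset`. If a simplex has a point mapped into a member `W_α`
at scale `ε`, the minimum diameter condition puts its whole image within distance `diam W_α ≤ ε` of
`W_α`. This neighbourhood has diameter at most `3ε`, so goodness places it in a single `W_β` at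
scale `3cε`. Consequently a path in `f⁻¹(W_α)` runs through simplices whose vertices form one
edge-connected set over `W_β`, and an edge walk over `W_α` traces a path in `f⁻¹(W_β)`. The two
pullbacks live on different sets, `|K|` and `V`; on the set of pairs `(v, x)` with `v` a vertex of
the carrier of `x` they can be compared, and there each refines the other after a shift by `η =
log(3c)` on the logarithmic scale. Both projections from this set are surjective, so pulling back
leaves the nerves unchanged.

Two index maps realizing the same refinement are contiguous on nerves, hence equal in homology
(`homologyMap_nerve_eq`). Homology is therefore a functor on families ordered by refinement, and
every comparison diagram commutes without any choice of compatible index maps. In particular the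
families of the two towers, taken alternately at spacing `η`, form one sequence of vector spaces
indexed by `ℤ`.

What remains is a weak stability statement, with constant `3`, proved by counting
(`IsRankFunction.bottleneckDist_le`). The grid `t + ℤη` is chosen off all birth and death values of
both modules. The number of diagram points in a grid cell of width `2η` is an alternating sum of
ranks at its corners; on the even cells these ranks come from one module, on the odd cells from the
other, and both are ranks of the alternating sequence. Hence the cells of width `η`, counted by the
alternating sequence, carry virtual points that refine both diagrams. Points of the two diagrams
that correspond to the same virtual point are less than `3η` apart, and all others are within `3η`
of the diagonal.

No loss in `log(1/s)` occurs: a set of diameter less than `s` is replaced by a ball of radius `s`,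
whose diameter is at most `2s ≤ 3ε`. The second summand of the bound is nonnegative slack. -/

namespace MultiscaleMapper

open Filter Topology

/-! ## Rank functions -/

/-- The monotonicity properties of the ranks of the structure maps of a persistence module:
`ρ` decreases when the interval grows, and the rectangle counts are nonnegative. -/
structure IsRankFunction {T : Type*} [Preorder T] (ρ : T → T → ℕ) : Prop where
  mono : ∀ {a' a b b' : T}, a' ≤ a → a ≤ b → b ≤ b' → ρ a' b' ≤ ρ a b
  frobenius : ∀ {a b c d : T}, a ≤ b → b ≤ c → c ≤ d → ρ a c + ρ b d ≤ ρ b c + ρ a d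

/-- A monotone integer valued function on an interval that is locally constant at the end points
is the sum of its jumps. -/
theorem exists_finset_sum_jumps {g : ℝ → ℤ} {J : ℝ → ℕ} {b : ℝ} :
    ∀ (n : ℕ) {a : ℝ}, a < b → (g b - g a).toNat ≤ n → MonotoneOn g (Set.Icc a b) →
      (∀ᶠ x in 𝓝[>] a, g x = g a) → (∀ᶠ x in 𝓝[<] b, g x = g b) →
      (∀ x ∈ Set.Ioo a b, ∀ᶠ δ in 𝓝[>] (0 : ℝ), g (x + δ) - g (x - δ) = J x) →
      ∃ T : Finset ℝ, (∀ x ∈ T, x ∈ Set.Ioo a b) ∧ (∀ x ∈ Set.Ioo a b, x ∉ T → J x = 0) ∧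
        ∑ x ∈ T, (J x : ℤ) = g b - g a := by
  have locConst : ∀ {u v z x : ℝ}, u < x → x < v → (∀ y ∈ Set.Ioo u v, g y = g z) →
      (∀ᶠ δ in 𝓝[>] (0 : ℝ), g (x + δ) - g (x - δ) = J x) → J x = 0 := by
    intro u v z x hu hv hc hJ
    have h1 : ∀ᶠ δ in 𝓝[>] (0 : ℝ), δ ∈ Set.Ioo 0 (min (x - u) (v - x)) :=
      Ioo_mem_nhdsGT (lt_min (by linarith) (by linarith))
    obtain ⟨δ, h2, h3, h4⟩ := (hJ.and h1).exists
    rw [lt_min_iff] at h4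
    rw [hc (x + δ) ⟨by linarith, by linarith⟩, hc (x - δ) ⟨by linarith, by linarith⟩] at h2
    omega
  have flat : ∀ {a : ℝ}, a < b → g b = g a → MonotoneOn g (Set.Icc a b) →
      (∀ x ∈ Set.Ioo a b, ∀ᶠ δ in 𝓝[>] (0 : ℝ), g (x + δ) - g (x - δ) = J x) →
      ∀ x ∈ Set.Ioo a b, J x = 0 := by
    intro a hab h hg hJ x hx
    refine locConst (z := a) hx.1 hx.2 (fun y hy => le_antisymm ?_ ?_) (hJ x hx)
    · rw [← h]
      exact hg ⟨hy.1.le, hy.2.le⟩ ⟨hab.le, le_rfl⟩ hy.2.le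
    · exact hg ⟨le_rfl, hab.le⟩ ⟨hy.1.le, hy.2.le⟩ hy.1.le
  intro n
  induction n with
  | zero =>
    intro a hab hn hg _ _ hJ
    have h1 : g a ≤ g b := hg ⟨le_rfl, hab.le⟩ ⟨hab.le, le_rfl⟩ hab.le
    have h2 : g b = g a := by omega
    exact ⟨∅, by simp, fun x hx _ => flat hab h2 hg hJ x hx, by simp [h2]⟩
  | succ n ih =>
    intro a hab hn hg ha hb hJ
    have h1 : g a ≤ g b := hg ⟨le_rfl, hab.le⟩ ⟨hab.le, le_rfl⟩ hab.le
    rcases h1.eq_or_lt with h2 | h2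
    · exact ⟨∅, by simp, fun x hx _ => flat hab h2.symm hg hJ x hx, by simp [h2]⟩
    -- The supremum `z` of `A` is the first jump. To its left `g` has the value `g a`, just to its
    -- right the value `g a + J z`, so the induction restarts from a point `a'` slightly beyond `z`.
    set A : Set ℝ := {x | x ∈ Set.Icc a b ∧ g x = g a} with hA
    have hAb : BddAbove A := ⟨b, fun x hx => hx.1.2⟩
    have haA : a ∈ A := ⟨⟨le_rfl, hab.le⟩, rfl⟩
    set z := sSup A with hz
    have haz : a < z := by
      obtain ⟨x, hx, hx'⟩ := (ha.and (Ioo_mem_nhdsGT hab)).exists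
      exact hx'.1.trans_le (le_csSup hAb ⟨⟨hx'.1.le, hx'.2.le⟩, hx⟩)
    have hzb : z < b := by
      obtain ⟨x, hx, hx'⟩ := (hb.and (Ioo_mem_nhdsLT hab)).exists
      refine lt_of_le_of_lt (csSup_le ⟨a, haA⟩ fun y hy => ?_) hx'.2
      by_contra! hxy
      have := hg ⟨hx'.1.le, hx'.2.le⟩ hy.1 hxy.le
      have := hy.2
      omega
    have hleft : ∀ x ∈ Set.Ioo a z, g x = g a := by
      intro x hx
      obtain ⟨y, hy, hxy⟩ := exists_lt_of_lt_csSup ⟨a, haA⟩ hx.2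
      have hxm : x ∈ Set.Icc a b := ⟨hx.1.le, (hx.2.trans hzb).le⟩
      refine le_antisymm ?_ (hg ⟨le_rfl, hab.le⟩ hxm hx.1.le)
      rw [← hy.2]
      exact hg hxm hy.1 hxy.le
    obtain ⟨d, hd, hd'⟩ := (mem_nhdsGT_iff_exists_Ioo_subset.1 ((hJ z ⟨haz, hzb⟩).and
      (Ioo_mem_nhdsGT (lt_min (sub_pos.2 haz) (sub_pos.2 hzb)))))
    have hright : ∀ x ∈ Set.Ioo z (z + d), g x = J z + g a ∧ x < b := by
      intro x hx
      have h := hd' (show x - z ∈ Set.Ioo 0 d from ⟨by linarith [hx.1], by linarith [hx.2]⟩)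
      obtain ⟨h3, h4, h5⟩ := h
      rw [lt_min_iff] at h5
      rw [hleft (z - (x - z)) ⟨by linarith, by linarith [hx.1]⟩, add_sub_cancel] at h3
      exact ⟨by omega, by linarith⟩
    have hd0 : 0 < d := hd
    set a' := z + d / 2 with ha'
    have ha'm : a' ∈ Set.Ioo z (z + d) := ⟨by linarith, by linarith⟩
    obtain ⟨hga', ha'b⟩ := hright a' ha'm
    -- Since `a'` exceeds `sSup A`, the jump at `z` is at least `1`; this is what lowers the bound
    -- `n`.
    have hpos : g a < g a' := by
      refine lt_of_le_of_ne (hg ⟨le_rfl, hab.le⟩ ⟨(haz.trans ha'm.1).le, ha'b.le⟩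
        (haz.trans ha'm.1).le) fun h => ?_
      exact absurd (le_csSup hAb (show a' ∈ A from ⟨⟨(haz.trans ha'm.1).le, ha'b.le⟩, h.symm⟩))
        (not_le.2 ha'm.1)
    obtain ⟨T, hT1, hT2, hT3⟩ := ih ha'b (by omega)
      (hg.mono (Set.Icc_subset_Icc (haz.trans ha'm.1).le le_rfl))
      (by
        filter_upwards [Ioo_mem_nhdsGT ha'm.2] with x hx
        rw [hga', (hright x ⟨ha'm.1.trans hx.1, hx.2⟩).1]) hb
      (fun x hx => hJ x ⟨haz.trans (ha'm.1.trans hx.1), hx.2⟩)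
    have hzT : z ∉ T := fun h => absurd (hT1 z h).1 (not_lt.2 ha'm.1.le)
    refine ⟨insert z T, ?_, ?_, ?_⟩
    · intro x hx
      rcases Finset.mem_insert.1 hx with rfl | hx
      · exact ⟨haz, hzb⟩
      · exact ⟨haz.trans (ha'm.1.trans (hT1 x hx).1), (hT1 x hx).2⟩
    · intro x hx hxT
      rw [Finset.mem_insert, not_or] at hxT
      rcases lt_trichotomy x z with h | h | h
      · exact locConst hx.1 h hleft (hJ x hx)
      · exact absurd h hxT.1
      · rcases le_or_gt x a' with h' | h'
        · exact locConst (z := a') h (h'.trans_lt ha'm.2)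
            (fun y hy => by rw [hga', (hright y hy).1]) (hJ x hx)
        · exact hT2 x ⟨h', hx.2⟩ hxT.2
    · rw [Finset.sum_insert hzT, hT3, hga']
      ring

/-! ## The diagram of a rank function -/

/-- The persistence diagram determined by a function of ranks. -/
noncomputable def rankDiagram (ρ : ℝ → ℝ → ℕ) : PersistenceDiagram
  | (a, (b : ℝ)) => sInf {n : ℕ | ∃ δ : ℝ, 0 < δ ∧ a + δ < b - δ ∧
      (n : ℤ) = (ρ (a + δ) (b - δ) : ℤ) - ρ (a + δ) (b + δ)
        - ρ (a - δ) (b - δ) + ρ (a - δ) (b + δ)}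
  | (a, ⊤) => sInf {n : ℕ | ∃ δ B : ℝ, 0 < δ ∧ a + δ < B ∧
      (n : ℤ) = (ρ (a + δ) B : ℤ) - ρ (a - δ) B}

theorem diagram_eq_rankDiagram {F : Type*} [Field F] {r : ℝ}
    (M : CategoryTheory.Functor (Set.Ici r) (ModuleCat F)) :
    diagram M = rankDiagram (rank M) := by
  funext p
  obtain ⟨a, b⟩ := p
  induction b using WithTop.recTopCoe <;> rfl

/-- The number of classes that are born at `x` and alive at `y`. -/
noncomputable def bornAt (ρ : ℝ → ℝ → ℕ) (x y : ℝ) : ℕ :=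
  sInf {n : ℕ | ∃ δ : ℝ, 0 < δ ∧ x + δ < y ∧ (n : ℤ) = (ρ (x + δ) y : ℤ) - ρ (x - δ) y}

/-- No `δ` is admissible on or below the diagonal, and `sInf ∅ = 0` in `ℕ`. -/
theorem rankDiagram_eq_zero_of_le {ρ : ℝ → ℝ → ℕ} {x y : ℝ} (h : y ≤ x) :
    rankDiagram ρ (x, (y : WithTop ℝ)) = 0 := by
  have : {n : ℕ | ∃ δ : ℝ, 0 < δ ∧ x + δ < y - δ ∧
      (n : ℤ) = (ρ (x + δ) (y - δ) : ℤ) - ρ (x + δ) (y + δ)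
        - ρ (x - δ) (y - δ) + ρ (x - δ) (y + δ)} = ∅ := by
    refine Set.eq_empty_of_forall_notMem ?_
    rintro n ⟨δ, h1, h2, -⟩
    linarith
  exact (congrArg sInf this).trans Nat.sInf_empty

namespace IsRankFunction

/-- The count in a square is a natural number by `frobenius`, and can only drop when the square
shrinks: `f1` to `f4` say that the four strips between the squares of sizes `δ` and `δ₀` have
nonnegative counts. Once the minimum is attained at `δ₀`, it therefore persists for all smaller `δ`.
-/
theorem rankDiagram_spec {ρ : ℝ → ℝ → ℕ} (hρ : IsRankFunction ρ) {x y : ℝ} (h : x < y) :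
    ∃ δ₀ > 0, ∀ δ, 0 < δ → δ ≤ δ₀ → x + δ < y - δ ∧
      (rankDiagram ρ (x, (y : WithTop ℝ)) : ℤ) = (ρ (x + δ) (y - δ) : ℤ) - ρ (x + δ) (y + δ)
        - ρ (x - δ) (y - δ) + ρ (x - δ) (y + δ) := by
  set S : Set ℕ := {n : ℕ | ∃ δ : ℝ, 0 < δ ∧ x + δ < y - δ ∧
      (n : ℤ) = (ρ (x + δ) (y - δ) : ℤ) - ρ (x + δ) (y + δ)
        - ρ (x - δ) (y - δ) + ρ (x - δ) (y + δ)} with hS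
  have hval : ∀ δ, 0 < δ → x + δ < y - δ → ∃ n ∈ S, (n : ℤ) = (ρ (x + δ) (y - δ) : ℤ)
      - ρ (x + δ) (y + δ) - ρ (x - δ) (y - δ) + ρ (x - δ) (y + δ) := by
    intro δ h1 h2
    have := hρ.frobenius (show x - δ ≤ x + δ by linarith) h2.le (show y - δ ≤ y + δ by linarith)
    have key : ((ρ (x + δ) (y - δ) + ρ (x - δ) (y + δ) -
      (ρ (x - δ) (y - δ) + ρ (x + δ) (y + δ)) : ℕ) : ℤ) = (ρ (x + δ) (y - δ) : ℤ)
      - ρ (x + δ) (y + δ) - ρ (x - δ) (y - δ) + ρ (x - δ) (y + δ) := by omega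
    exact ⟨_, ⟨δ, h1, h2, key⟩, key⟩
  have hne : S.Nonempty := by
    obtain ⟨n, hn, -⟩ := hval ((y - x) / 4) (by linarith) (by linarith)
    exact ⟨n, hn⟩
  obtain ⟨δ₀, h0, h0', hδ₀⟩ := Nat.sInf_mem hne
  refine ⟨δ₀, h0, fun δ h1 h2 => ⟨by linarith, ?_⟩⟩
  obtain ⟨n, hn, hn'⟩ := hval δ h1 (by linarith)
  have h3 : sInf S ≤ n := Nat.sInf_le hn
  change ((sInf S : ℕ) : ℤ) = _
  have f1 := hρ.frobenius (show x - δ₀ ≤ x - δ by linarith) (show x - δ ≤ y - δ₀ by linarith)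
    (show y - δ₀ ≤ y + δ₀ by linarith)
  have f2 := hρ.frobenius (show x + δ ≤ x + δ₀ by linarith) (show x + δ₀ ≤ y - δ₀ by linarith)
    (show y - δ₀ ≤ y + δ₀ by linarith)
  have f3 := hρ.frobenius (show x - δ ≤ x + δ by linarith) (show x + δ ≤ y - δ₀ by linarith)
    (show y - δ₀ ≤ y - δ by linarith)
  have f4 := hρ.frobenius (show x - δ ≤ x + δ by linarith) (show x + δ ≤ y + δ by linarith)
    (show y + δ ≤ y + δ₀ by linarith)
  omega

theorem bornAt_spec {ρ : ℝ → ℝ → ℕ} (hρ : IsRankFunction ρ) {x y : ℝ} (h : x < y) :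
    ∃ δ₀ > 0, ∀ δ, 0 < δ → δ ≤ δ₀ → x + δ < y ∧
      (bornAt ρ x y : ℤ) = (ρ (x + δ) y : ℤ) - ρ (x - δ) y := by
  set S : Set ℕ := {n : ℕ | ∃ δ : ℝ, 0 < δ ∧ x + δ < y ∧
    (n : ℤ) = (ρ (x + δ) y : ℤ) - ρ (x - δ) y} with hS
  have hval : ∀ δ, 0 < δ → x + δ < y → ∃ n ∈ S, (n : ℤ) = (ρ (x + δ) y : ℤ) - ρ (x - δ) y := by
    intro δ h1 h2
    have := hρ.mono (show x - δ ≤ x + δ by linarith) h2.le le_rfl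
    have key : ((ρ (x + δ) y - ρ (x - δ) y : ℕ) : ℤ) = (ρ (x + δ) y : ℤ) - ρ (x - δ) y := by omega
    exact ⟨_, ⟨δ, h1, h2, key⟩, key⟩
  have hne : S.Nonempty := by
    obtain ⟨n, hn, -⟩ := hval ((y - x) / 2) (by linarith) (by linarith)
    exact ⟨n, hn⟩
  obtain ⟨δ₀, h0, h0', hδ₀⟩ := Nat.sInf_mem hne
  refine ⟨δ₀, h0, fun δ h1 h2 => ⟨by linarith, ?_⟩⟩
  obtain ⟨n, hn, hn'⟩ := hval δ h1 (by linarith)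
  have h3 : sInf S ≤ n := Nat.sInf_le hn
  change ((sInf S : ℕ) : ℤ) = _
  have f1 := hρ.mono (show x - δ₀ ≤ x - δ by linarith) (show x - δ ≤ y by linarith) le_rfl
  have f2 := hρ.mono (show x + δ ≤ x + δ₀ by linarith) h0'.le le_rfl
  omega

theorem rankDiagram_top_spec {ρ : ℝ → ℝ → ℕ} (hρ : IsRankFunction ρ) (x : ℝ) :
    ∃ δ₀ > 0, ∃ B₀, x + δ₀ < B₀ ∧ ∀ δ B, 0 < δ → δ ≤ δ₀ → B₀ ≤ B →
      (rankDiagram ρ (x, ⊤) : ℤ) = (ρ (x + δ) B : ℤ) - ρ (x - δ) B := by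
  set S : Set ℕ := {n : ℕ | ∃ δ B : ℝ, 0 < δ ∧ x + δ < B ∧
    (n : ℤ) = (ρ (x + δ) B : ℤ) - ρ (x - δ) B} with hS
  have hval : ∀ δ B, 0 < δ → x + δ < B → ∃ n ∈ S, (n : ℤ) = (ρ (x + δ) B : ℤ) - ρ (x - δ) B := by
    intro δ B h1 h2
    have := hρ.mono (show x - δ ≤ x + δ by linarith) h2.le le_rfl
    have key : ((ρ (x + δ) B - ρ (x - δ) B : ℕ) : ℤ) = (ρ (x + δ) B : ℤ) - ρ (x - δ) B := by omega
    exact ⟨_, ⟨δ, B, h1, h2, key⟩, key⟩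
  have hne : S.Nonempty := by
    obtain ⟨n, hn, -⟩ := hval 1 (x + 2) (by linarith) (by linarith)
    exact ⟨n, hn⟩
  obtain ⟨δ₀, B₀, h0, h0', hδ₀⟩ := Nat.sInf_mem hne
  refine ⟨δ₀, h0, B₀, h0', fun δ B h1 h2 hB => ?_⟩
  obtain ⟨n, hn, hn'⟩ := hval δ B h1 (by linarith)
  have h3 : sInf S ≤ n := Nat.sInf_le hn
  change ((sInf S : ℕ) : ℤ) = _
  have f1 := hρ.mono (show x - δ₀ ≤ x - δ by linarith) (show x - δ ≤ B by linarith) le_rfl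
  have f2 := hρ.mono (show x + δ ≤ x + δ₀ by linarith) (h0'.le.trans hB) le_rfl
  have f3 := hρ.frobenius (show x - δ₀ ≤ x + δ₀ by linarith) h0'.le hB
  omega

theorem bornAt_antitone {ρ : ℝ → ℝ → ℕ} (hρ : IsRankFunction ρ) {x y y' : ℝ} (h : x < y)
    (h' : y ≤ y') : bornAt ρ x y' ≤ bornAt ρ x y := by
  obtain ⟨δ, hδ, H⟩ := hρ.bornAt_spec h
  obtain ⟨δ', hδ', H'⟩ := hρ.bornAt_spec (h.trans_le h')
  obtain ⟨h1, h2⟩ := H (min δ δ') (lt_min hδ hδ') (min_le_left _ _)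
  obtain ⟨h3, h4⟩ := H' (min δ δ') (lt_min hδ hδ') (min_le_right _ _)
  have hm := lt_min hδ hδ'
  have := hρ.frobenius (show x - min δ δ' ≤ x + min δ δ' by linarith) h1.le h'
  omega

/-- Exhibits the multiplicity of `(x, y)` as a jump of `bornAt ρ x`, which reduces planar counts to
two successive counts on the line. The difference on the left is the count in a rectangle of
half-width `e ≤ δ` and half-height `δ`; it lies between the counts in the squares of sizes `e` and
`δ`, and these are equal. -/
theorem eventually_bornAt_sub {ρ : ℝ → ℝ → ℕ} (hρ : IsRankFunction ρ) {x y : ℝ} (h : x < y) :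
    ∀ᶠ δ in 𝓝[>] (0 : ℝ), (bornAt ρ x (y - δ) : ℤ) - bornAt ρ x (y + δ) =
      rankDiagram ρ (x, (y : WithTop ℝ)) := by
  obtain ⟨δ₀, h0, H⟩ := hρ.rankDiagram_spec h
  filter_upwards [Ioc_mem_nhdsGT h0] with δ hδ
  obtain ⟨h1, h2⟩ := H δ hδ.1 hδ.2
  have hδ0 := hδ.1
  obtain ⟨d, hd, H1⟩ := hρ.bornAt_spec (show x < y - δ by linarith)
  obtain ⟨d', hd', H2⟩ := hρ.bornAt_spec (show x < y + δ by linarith)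
  have hm : 0 < min δ (min d d') := lt_min hδ.1 (lt_min hd hd')
  set e := min δ (min d d') with he
  have e1 : e ≤ δ := min_le_left _ _
  obtain ⟨h3, h4⟩ := H1 e hm ((min_le_right _ _).trans (min_le_left _ _))
  obtain ⟨h5, h6⟩ := H2 e hm ((min_le_right _ _).trans (min_le_right _ _))
  obtain ⟨h7, h8⟩ := H e hm (e1.trans hδ.2)
  have f1 := hρ.frobenius (show x - δ ≤ x - e by linarith) (show x - e ≤ y - δ by linarith)
    (show y - δ ≤ y + δ by linarith)
  have f2 := hρ.frobenius (show x + e ≤ x + δ by linarith) (show x + δ ≤ y - δ by linarith)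
    (show y - δ ≤ y + δ by linarith)
  have f3 := hρ.frobenius (show x - e ≤ x + e by linarith) (show x + e ≤ y - δ by linarith)
    (show y - δ ≤ y - e by linarith)
  have f4 := hρ.frobenius (show x - e ≤ x + e by linarith) (show x + e ≤ y + e by linarith)
    (show y + e ≤ y + δ by linarith)
  omega

theorem eventually_bornAt_eq_top {ρ : ℝ → ℝ → ℕ} (hρ : IsRankFunction ρ) (x : ℝ) :
    ∀ᶠ B in atTop, bornAt ρ x B = rankDiagram ρ (x, ⊤) := by
  obtain ⟨δ₀, h0, B₀, hB₀, H⟩ := hρ.rankDiagram_top_spec x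
  filter_upwards [eventually_ge_atTop B₀] with B hB
  obtain ⟨d, hd, H'⟩ := hρ.bornAt_spec (show x < B by linarith)
  have h1 := H (min δ₀ d) B (lt_min h0 hd) (min_le_left _ _) hB
  have h2 := (H' (min δ₀ d) (lt_min h0 hd) (min_le_right _ _)).2
  omega

end IsRankFunction

/-! ## Regular values -/

/-- A value near which the ranks do not change, as births or as deaths. -/
def IsRegularValue (ρ : ℝ → ℝ → ℕ) (x : ℝ) : Prop :=
  (∀ q, x < q → ∀ᶠ z in 𝓝 x, ρ z q = ρ x q) ∧ ∀ q, q < x → ∀ᶠ z in 𝓝 x, ρ q z = ρ q x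

namespace IsRankFunction

/-- For each rational `q` the ranks towards or from `q` form a monotone function, which has
countably many discontinuities and, being integer valued, is locally constant elsewhere. Any real
parameter is separated from `x` by a rational `q`, and `frobenius` carries local constancy from `q`
to that parameter. -/
theorem countable_not_isRegularValue {ρ : ℝ → ℝ → ℕ} (hρ : IsRankFunction ρ) :
    {x | ¬ IsRegularValue ρ x}.Countable := by
  have hup : ∀ q : ℝ, Monotone fun z => ρ (min z q) q := fun q z z' h =>
    hρ.mono (min_le_min_right _ h) (min_le_right _ _) le_rfl
  have hdown : ∀ q : ℝ, Antitone fun z => ρ q (max z q) := fun q z z' h =>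
    hρ.mono le_rfl (le_max_right _ _) (max_le_max_right _ h)
  refine ((Set.countable_iUnion fun q : ℚ => (hup q).countable_not_continuousAt).union
    (Set.countable_iUnion fun q : ℚ => (hdown q).countable_not_continuousAt)).mono ?_
  intro x hx
  by_contra hx'
  simp only [Set.mem_union, Set.mem_iUnion, Set.mem_ofPred_eq, not_or, not_exists, not_not] at hx'
  refine hx ⟨fun p hp => ?_, fun p hp => ?_⟩
  · obtain ⟨q, hxq, hqp⟩ := exists_rat_btwn hp
    have h1 : ∀ᶠ z in 𝓝 x, ρ (min z q) q = ρ (min x q) q :=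
      hx'.1 q ((isOpen_discrete {ρ (min x q) q}).mem_nhds rfl)
    filter_upwards [h1, Iio_mem_nhds hxq] with z hz hzq
    rw [min_eq_left (le_of_lt hzq), min_eq_left hxq.le] at hz
    rcases le_total z x with h | h
    · have := hρ.frobenius h hxq.le hqp.le
      have := hρ.mono h hp.le (le_refl p)
      omega
    · have := hρ.frobenius h (le_of_lt hzq) hqp.le
      have := hρ.mono h (le_of_lt (lt_trans hzq hqp)) (le_refl p)
      omega
  · obtain ⟨q, hpq, hqx⟩ := exists_rat_btwn hp
    have h1 : ∀ᶠ z in 𝓝 x, ρ q (max z q) = ρ q (max x q) :=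
      hx'.2 q ((isOpen_discrete {ρ q (max x q)}).mem_nhds rfl)
    filter_upwards [h1, Ioi_mem_nhds hqx] with z hz hzq
    rw [max_eq_left (le_of_lt hzq), max_eq_left hqx.le] at hz
    rcases le_total z x with h | h
    · have := hρ.frobenius hpq.le (le_of_lt hzq) h
      have := hρ.mono (le_refl p) (hpq.trans hzq).le h
      omega
    · have := hρ.frobenius hpq.le hqx.le h
      have := hρ.mono (le_refl p) hp.le h
      omega

/-! ### Consequences of regularity: empty grid lines and counts in rectangles -/

theorem bornAt_eq_zero {ρ : ℝ → ℝ → ℕ} (hρ : IsRankFunction ρ) {x y : ℝ}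
    (hx : IsRegularValue ρ x) (h : x < y) : bornAt ρ x y = 0 := by
  obtain ⟨d, hd, H⟩ := hρ.bornAt_spec h
  obtain ⟨e, he, H'⟩ := Metric.eventually_nhds_iff.1 (hx.1 y h)
  have hm : 0 < min d (e / 2) := lt_min hd (by linarith)
  have hme : min d (e / 2) < e := (min_le_right _ _).trans_lt (by linarith)
  have h1 := (H _ hm (min_le_left _ _)).2
  have h2 := @H' (x + min d (e / 2)) (by simpa [abs_of_pos hm] using hme)
  have h3 := @H' (x - min d (e / 2)) (by simpa [dist_eq_norm, abs_of_pos hm] using hme)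
  omega

/-- The birth window `m` depends on `z`, so regularity cannot be applied to `x ± m` directly. It is
applied once, at the midpoint of `x` and `y`; `frobenius` then transfers the constancy to all
earlier births at once. -/
theorem isRegularValue_eventually_bornAt {ρ : ℝ → ℝ → ℕ} (hρ : IsRankFunction ρ) {x y : ℝ}
    (hy : IsRegularValue ρ y) (h : x < y) : ∀ᶠ z in 𝓝 y, bornAt ρ x z = bornAt ρ x y := by
  have hq : x < (x + y) / 2 := by linarith
  filter_upwards [hy.2 ((x + y) / 2) (by linarith),
    Ioi_mem_nhds (show (x + y) / 2 < y by linarith)] with z hz hz'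
  have hz'' : (x + y) / 2 < z := hz'
  obtain ⟨d, hd, H⟩ := hρ.bornAt_spec h
  obtain ⟨e, he, H'⟩ := hρ.bornAt_spec (show x < z by linarith)
  have hm : 0 < min (min d e) ((y - x) / 2) := lt_min (lt_min hd he) (by linarith)
  set m := min (min d e) ((y - x) / 2) with hmdef
  have h1 := (H m hm ((min_le_left _ _).trans (min_le_left _ _))).2
  have h2 := (H' m hm ((min_le_left _ _).trans (min_le_right _ _))).2
  have hm2 : m ≤ (y - x) / 2 := min_le_right _ _
  rcases le_total z y with h | h
  · have f1 := hρ.frobenius (show x + m ≤ (x + y) / 2 by linarith) hz''.le h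
    have f2 := hρ.frobenius (show x - m ≤ (x + y) / 2 by linarith) hz''.le h
    have f3 := hρ.mono (le_refl (x + m)) (show x + m ≤ z by linarith) h
    have f4 := hρ.mono (le_refl (x - m)) (show x - m ≤ z by linarith) h
    omega
  · have f1 := hρ.frobenius (show x + m ≤ (x + y) / 2 by linarith)
      (show (x + y) / 2 ≤ y by linarith) h
    have f2 := hρ.frobenius (show x - m ≤ (x + y) / 2 by linarith)
      (show (x + y) / 2 ≤ y by linarith) h
    have f3 := hρ.mono (le_refl (x + m)) (show x + m ≤ y by linarith) h
    have f4 := hρ.mono (le_refl (x - m)) (show x - m ≤ y by linarith) h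
    omega

theorem rankDiagram_eq_zero_of_birth {ρ : ℝ → ℝ → ℕ} (hρ : IsRankFunction ρ) {x : ℝ}
    (hx : IsRegularValue ρ x) (y : WithTop ℝ) : rankDiagram ρ (x, y) = 0 := by
  induction y using WithTop.recTopCoe with
  | top =>
    obtain ⟨B, h1, h2⟩ := ((hρ.eventually_bornAt_eq_top x).and (eventually_gt_atTop x)).exists
    rw [← h1, hρ.bornAt_eq_zero hx h2]
  | coe y =>
    rcases le_or_gt y x with h | h
    · exact rankDiagram_eq_zero_of_le h
    · obtain ⟨δ, h1, h2⟩ := ((hρ.eventually_bornAt_sub h).and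
        (Ioo_mem_nhdsGT (sub_pos.2 h))).exists
      rw [hρ.bornAt_eq_zero hx (show x < y - δ by linarith [h2.2]),
        hρ.bornAt_eq_zero hx (show x < y + δ by linarith [h2.1])] at h1
      omega

theorem rankDiagram_eq_zero_of_death {ρ : ℝ → ℝ → ℕ} (hρ : IsRankFunction ρ) {x y : ℝ}
    (hy : IsRegularValue ρ y) : rankDiagram ρ (x, (y : WithTop ℝ)) = 0 := by
  rcases le_or_gt y x with h | h
  · exact rankDiagram_eq_zero_of_le h
  obtain ⟨e, he, H⟩ := Metric.eventually_nhds_iff.1 (hρ.isRegularValue_eventually_bornAt hy h)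
  obtain ⟨δ, h1, h2⟩ := ((hρ.eventually_bornAt_sub h).and (Ioo_mem_nhdsGT he)).exists
  rw [@H (y - δ) (by simpa [dist_eq_norm, abs_of_pos h2.1] using h2.2),
    @H (y + δ) (by simpa [dist_eq_norm, abs_of_pos h2.1] using h2.2)] at h1
  omega

/-- The number of points born in `(a, b)` and alive at `y`. -/
theorem exists_finset_sum_bornAt {ρ : ℝ → ℝ → ℕ} (hρ : IsRankFunction ρ) {a b y : ℝ}
    (hab : a < b) (hby : b < y) (ha : IsRegularValue ρ a) (hb : IsRegularValue ρ b) :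
    ∃ T : Finset ℝ, (∀ x ∈ T, x ∈ Set.Ioo a b) ∧ (∀ x ∈ Set.Ioo a b, x ∉ T → bornAt ρ x y = 0) ∧
      ∑ x ∈ T, (bornAt ρ x y : ℤ) = ρ b y - ρ a y := by
  refine exists_finset_sum_jumps (g := fun x => (ρ x y : ℤ)) _ hab le_rfl ?_ ?_ ?_ ?_
  · intro u hu v hv huv
    exact Nat.cast_le.2 (hρ.mono huv (hv.2.trans hby.le) le_rfl)
  · filter_upwards [nhdsWithin_le_nhds (ha.1 y (hab.trans hby))] with x hx
    rw [hx]
  · filter_upwards [nhdsWithin_le_nhds (hb.1 y hby)] with x hx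
    rw [hx]
  · intro x hx
    obtain ⟨d, hd, H⟩ := hρ.bornAt_spec (hx.2.trans hby)
    filter_upwards [Ioc_mem_nhdsGT hd] with δ hδ
    exact (H δ hδ.1 hδ.2).2.symm

/-- The number of points born at `x` that die in `(c, d)`. -/
theorem exists_finset_sum_rankDiagram {ρ : ℝ → ℝ → ℕ} (hρ : IsRankFunction ρ) {x c d : ℝ}
    (hxc : x < c) (hcd : c < d) (hc : IsRegularValue ρ c) (hd : IsRegularValue ρ d) :
    ∃ T : Finset ℝ, (∀ y ∈ T, y ∈ Set.Ioo c d) ∧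
      (∀ y ∈ Set.Ioo c d, y ∉ T → rankDiagram ρ (x, (y : WithTop ℝ)) = 0) ∧
      ∑ y ∈ T, (rankDiagram ρ (x, (y : WithTop ℝ)) : ℤ) = bornAt ρ x c - bornAt ρ x d := by
  -- The number of survivors decreases with `y`, whence the sign.
  have := exists_finset_sum_jumps (g := fun y => -(bornAt ρ x y : ℤ))
    (J := fun y => rankDiagram ρ (x, (y : WithTop ℝ))) _ hcd le_rfl ?_ ?_ ?_ ?_
  · obtain ⟨T, h1, h2, h3⟩ := this
    exact ⟨T, h1, h2, by rw [h3]; ring⟩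
  · intro u hu v hv huv
    exact neg_le_neg (Nat.cast_le.2 (hρ.bornAt_antitone (hxc.trans_le hu.1) huv))
  · filter_upwards [nhdsWithin_le_nhds (hρ.isRegularValue_eventually_bornAt hc hxc)] with z hz
    rw [hz]
  · filter_upwards [nhdsWithin_le_nhds
      (hρ.isRegularValue_eventually_bornAt hd (hxc.trans hcd))] with z hz
    rw [hz]
  · intro y hy
    filter_upwards [hρ.eventually_bornAt_sub (hxc.trans hy.1)] with δ hδ
    rw [← hδ]
    ring

/-- The number of points of the diagram in the rectangle `(a, b) × (c, d)`. -/
theorem exists_finset_sum_rectangle {ρ : ℝ → ℝ → ℕ} (hρ : IsRankFunction ρ) {a b c d : ℝ}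
    (hab : a < b) (hbc : b < c) (hcd : c < d) (ha : IsRegularValue ρ a)
    (hb : IsRegularValue ρ b) (hc : IsRegularValue ρ c) (hd : IsRegularValue ρ d) :
    ∃ T : Finset (ℝ × ℝ), (∀ p ∈ T, p.1 ∈ Set.Ioo a b ∧ p.2 ∈ Set.Ioo c d) ∧
      (∀ p : ℝ × ℝ, p.1 ∈ Set.Ioo a b → p.2 ∈ Set.Ioo c d → p ∉ T →
        rankDiagram ρ (p.1, (p.2 : WithTop ℝ)) = 0) ∧
      ∑ p ∈ T, (rankDiagram ρ (p.1, (p.2 : WithTop ℝ)) : ℤ) =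
        ρ b c - ρ a c - ρ b d + ρ a d := by
  classical
  obtain ⟨T, hT1, hT2, hT3⟩ := hρ.exists_finset_sum_bornAt hab hbc ha hb
  obtain ⟨T', hT'1, hT'2, hT'3⟩ := hρ.exists_finset_sum_bornAt hab (hbc.trans hcd) ha hb
  -- One finite set of births that serves both heights: enlarging `T` or `T'` adds only zero terms
  -- to the corresponding sum.
  set U := T ∪ T' with hU
  have hUab : ∀ x ∈ U, x ∈ Set.Ioo a b := fun x hx =>
    (Finset.mem_union.1 hx).elim (hT1 x) (hT'1 x)
  have s1 : ∑ x ∈ U, (bornAt ρ x c : ℤ) = ρ b c - ρ a c := by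
    rw [← hT3]
    refine (Finset.sum_subset Finset.subset_union_left fun x hx hx' => ?_).symm
    rw [hT2 x (hUab x hx) hx', Nat.cast_zero]
  have s2 : ∑ x ∈ U, (bornAt ρ x d : ℤ) = ρ b d - ρ a d := by
    rw [← hT'3]
    refine (Finset.sum_subset Finset.subset_union_right fun x hx hx' => ?_).symm
    rw [hT'2 x (hUab x hx) hx', Nat.cast_zero]
  have hS : ∀ x : ℝ, ∃ S : Finset ℝ, x < c → (∀ y ∈ S, y ∈ Set.Ioo c d) ∧
      (∀ y ∈ Set.Ioo c d, y ∉ S → rankDiagram ρ (x, (y : WithTop ℝ)) = 0) ∧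
      ∑ y ∈ S, (rankDiagram ρ (x, (y : WithTop ℝ)) : ℤ) = bornAt ρ x c - bornAt ρ x d := by
    intro x
    by_cases hx : x < c
    · obtain ⟨S, hS⟩ := hρ.exists_finset_sum_rankDiagram hx hcd hc hd
      exact ⟨S, fun _ => hS⟩
    · exact ⟨∅, fun h => absurd h hx⟩
  choose S hS using hS
  refine ⟨(U.sigma S).map (Equiv.sigmaEquivProd ℝ ℝ).toEmbedding, ?_, ?_, ?_⟩
  · intro p hp
    rw [Finset.mem_map_equiv, Finset.mem_sigma] at hp
    have h1 := hUab _ hp.1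
    exact ⟨h1, (hS _ (h1.2.trans hbc)).1 _ hp.2⟩
  · intro p hp1 hp2 hp
    rw [Finset.mem_map_equiv, Finset.mem_sigma, not_and_or] at hp
    rcases hp with hp | hp
    · have h0 : bornAt ρ p.1 c = 0 := hT2 _ hp1 fun h => hp (Finset.mem_union_left _ h)
      obtain ⟨δ, h1, h2⟩ := ((hρ.eventually_bornAt_sub (hp1.2.trans (hbc.trans hp2.1))).and
        (Ioo_mem_nhdsGT (sub_pos.2 hp2.1))).exists
      have h3 := hρ.bornAt_antitone (hp1.2.trans hbc) (show c ≤ p.2 - δ by linarith [h2.2])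
      omega
    · exact (hS _ (hp1.2.trans hbc)).2.1 _ hp2 hp
  · rw [Finset.sum_map, Finset.sum_sigma]
    calc _ = ∑ x ∈ U, ((bornAt ρ x c : ℤ) - bornAt ρ x d) :=
          Finset.sum_congr rfl fun x hx => (hS x ((hUab x hx).2.trans hbc)).2.2
      _ = _ := by
          rw [Finset.sum_sub_distrib, s1, s2]
          ring

/-- The number of points of the diagram that are born in `(a, b)` and never die. -/
theorem exists_finset_sum_top {ρ : ℝ → ℝ → ℕ} (hρ : IsRankFunction ρ) {a b : ℝ}
    (hab : a < b) (ha : IsRegularValue ρ a) (hb : IsRegularValue ρ b) :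
    ∃ T : Finset ℝ, (∀ x ∈ T, x ∈ Set.Ioo a b) ∧
      (∀ x ∈ Set.Ioo a b, x ∉ T → rankDiagram ρ (x, ⊤) = 0) ∧
      ∀ᶠ B in atTop, ∑ x ∈ T, (rankDiagram ρ (x, ⊤) : ℤ) = ρ b B - ρ a B := by
  -- The births found at height `b + 1` suffice for every later `B`, because `bornAt` decreases with
  -- the height and so cannot become positive at a new place.
  obtain ⟨T, hT1, hT2, -⟩ := hρ.exists_finset_sum_bornAt hab (lt_add_one b) ha hb
  refine ⟨T, hT1, fun x hx hxT => ?_, ?_⟩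
  · obtain ⟨B, h1, h2⟩ := ((hρ.eventually_bornAt_eq_top x).and
      (eventually_ge_atTop (b + 1))).exists
    have := hρ.bornAt_antitone (hx.2.trans (lt_add_one b)) h2
    have := hT2 x hx hxT
    omega
  · have h1 : ∀ᶠ B in atTop, ∀ x ∈ T, bornAt ρ x B = rankDiagram ρ (x, ⊤) :=
      (Filter.eventually_all_finset T).2 fun x _ => hρ.eventually_bornAt_eq_top x
    filter_upwards [h1, eventually_ge_atTop (b + 1)] with B hB hB'
    obtain ⟨T', hT'1, hT'2, hT'3⟩ := hρ.exists_finset_sum_bornAt hab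
      (show b < B by linarith) ha hb
    rw [← hT'3]
    refine Finset.sum_congr_of_eq_on_inter ?_ ?_ ?_
    · intro x hx hx'
      rw [← hB x hx, hT'2 x (hT1 x hx) hx', Nat.cast_zero]
    · intro x hx hx'
      have := hρ.bornAt_antitone ((hT'1 x hx).2.trans (lt_add_one b)) hB'
      have := hT2 x (hT'1 x hx) hx'
      omega
    · intro x hx _
      rw [hB x hx]

end IsRankFunction
end MultiscaleMapper

namespace MultiscaleMapper

open Filter Topology

/-! ## Counting and matching points -/

/-- Outside `T` the fibre of `u` contributes only copies of `Fin 0`. This turns sums of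
multiplicities into cardinalities of sets of points, from which bijections can be drawn. -/
theorem finite_fiber_and_card {ι κ : Type*} (D : ι → ℕ) (u : ι → κ) (c : κ) (T : Finset ι)
    (hT : ∀ x ∈ T, u x = c) (hT' : ∀ x, u x = c → x ∉ T → D x = 0) :
    Finite {p : Σ x, Fin (D x) // u p.1 = c} ∧
      Nat.card {p : Σ x, Fin (D x) // u p.1 = c} = ∑ x ∈ T, D x := by
  have h : {p : Σ x, Fin (D x) | u p.1 = c} = ↑(T.sigma fun x => (Finset.univ : Finset (Fin (D x)))) := by
    ext ⟨x, n⟩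
    simp only [Finset.coe_sigma, Set.mem_sigma_iff, Finset.mem_coe, Finset.mem_univ, and_true]
    refine ⟨fun hx => ?_, hT x⟩
    by_contra hxT
    have h0 := hT' x hx hxT
    have := n.2
    omega
  have h2 : Nat.card {p : Σ x, Fin (D x) | u p.1 = c} = ∑ x ∈ T, D x := by
    rw [h, Nat.card_coe_set_eq, Set.ncard_coe_finset, Finset.card_sigma]
    simp
  refine ⟨?_, h2⟩
  have : {p : Σ x, Fin (D x) | u p.1 = c}.Finite := by
    rw [h]
    exact Finset.finite_toSet _
  exact this.to_subtype

/-- Bijections between the fibres over the admissible labels glue to one that preserves labels. -/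
theorem exists_equiv_of_card_fibers {α β κ : Type*} (u : α → κ) (v : β → κ) (G : κ → Prop)
    (h : ∀ c, G c → Nonempty ({a // u a = c} ≃ {b // v b = c})) :
    ∃ e : {a // G (u a)} ≃ {b // G (v b)}, ∀ a, v (e a).1 = u a.1 := by
  have E : ∀ c : {c // G c}, Nonempty
      ({a : {a // G (u a)} // (⟨u a.1, a.2⟩ : {c // G c}) = c} ≃
        {b : {b // G (v b)} // (⟨v b.1, b.2⟩ : {c // G c}) = c}) := by
    intro c
    obtain ⟨e⟩ := h c.1 c.2
    refine ⟨(?_ : _ ≃ {a // u a = c.1}).trans (e.trans (?_ : _ ≃ {b // v b = c.1}).symm)⟩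
    · exact ⟨fun a => ⟨a.1.1, congrArg Subtype.val a.2⟩,
        fun a => ⟨⟨a.1, by rw [a.2]; exact c.2⟩, Subtype.ext a.2⟩, fun _ => rfl, fun _ => rfl⟩
    · exact ⟨fun a => ⟨a.1.1, congrArg Subtype.val a.2⟩,
        fun a => ⟨⟨a.1, by rw [a.2]; exact c.2⟩, Subtype.ext a.2⟩, fun _ => rfl, fun _ => rfl⟩
  exact ⟨Equiv.ofFiberEquiv fun c => (E c).some, fun a =>
    congrArg Subtype.val (Equiv.ofFiberEquiv_map (fun c => (E c).some) a)⟩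

/-! ## Grid cells -/

/-- The number of points in a grid cell that is read off from the ranks at the grid points. -/
noncomputable def cellCount (p : ℤ → ℤ → ℕ) : ℤ × WithTop ℤ → ℕ
  | (i, (j : ℤ)) => p (i + 1) j + p i (j + 1) - (p i j + p (i + 1) (j + 1))
  | (i, ⊤) => sInf {n : ℕ | ∃ j : ℤ, i + 1 ≤ j ∧ n = p (i + 1) j - p i j}

/-- By `frobenius` the subtraction in `cellCount` is not truncated. -/
theorem IsRankFunction.cellCount_coe {p : ℤ → ℤ → ℕ} (hp : IsRankFunction p) {i j : ℤ}
    (h : i + 1 ≤ j) : (cellCount p (i, (j : WithTop ℤ)) : ℤ) =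
      p (i + 1) j - p i j - p (i + 1) (j + 1) + p i (j + 1) := by
  have := hp.frobenius (show i ≤ i + 1 by omega) h (show j ≤ j + 1 by omega)
  have h2 : cellCount p (i, (j : WithTop ℤ)) =
    p (i + 1) j + p i (j + 1) - (p i j + p (i + 1) (j + 1)) := rfl
  omega

/-- The differences `p (i + 1) j - p i j` are natural numbers that decrease with `j`, so they become
equal to their minimum. -/
theorem IsRankFunction.cellCount_top {p : ℤ → ℤ → ℕ} (hp : IsRankFunction p) (i : ℤ) :
    ∀ᶠ j in atTop, (cellCount p (i, ⊤) : ℤ) = p (i + 1) j - p i j := by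
  set S := {n : ℕ | ∃ j : ℤ, i + 1 ≤ j ∧ n = p (i + 1) j - p i j} with hS
  have hne : S.Nonempty := ⟨_, i + 1, le_rfl, rfl⟩
  obtain ⟨j₀, h0, hj₀⟩ := Nat.sInf_mem hne
  filter_upwards [eventually_ge_atTop j₀] with j hj
  have h1 : sInf S ≤ p (i + 1) j - p i j := Nat.sInf_le ⟨j, h0.trans hj, rfl⟩
  have h2 := hp.frobenius (show i ≤ i + 1 by omega) h0 hj
  have h3 := hp.mono (show i ≤ i + 1 by omega) (h0.trans hj) le_rfl
  have h4 := hp.mono (show i ≤ i + 1 by omega) h0 le_rfl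
  change ((sInf S : ℕ) : ℤ) = _
  omega

/-- The cell of the coarse grid (of width `2`, with offset `o`) that contains a cell. -/
def coarseCell (o : ℤ) (c : ℤ × WithTop ℤ) : ℤ × WithTop ℤ :=
  ((c.1 - o) / 2, c.2.map fun l => (l - o) / 2)

/-- The cell that contains a point, for the grid with offset `u` and width `h`. -/
noncomputable def gridCell (u h : ℝ) (x : ℝ × WithTop ℝ) : ℤ × WithTop ℤ :=
  (⌊(x.1 - u) / h⌋, x.2.map fun y => ⌊(y - u) / h⌋)

/-- The cell is far from the diagonal. -/
def IsFarCell (c : ℤ × WithTop ℤ) : Prop := ((c.1 + 2 : ℤ) : WithTop ℤ) ≤ c.2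

theorem floor_grid_eq_iff {u h x : ℝ} (hh : 0 < h) {i : ℤ} :
    ⌊(x - u) / h⌋ = i ↔ u + i * h ≤ x ∧ x < u + (i + 1 : ℤ) * h := by
  rw [Int.floor_eq_iff, le_div_iff₀ hh, div_lt_iff₀ hh]
  push_cast
  constructor <;> rintro ⟨h1, h2⟩ <;> constructor <;> linarith

theorem gridCell_eq_coe_iff {u h : ℝ} (hh : 0 < h) {x : ℝ × WithTop ℝ} {i j : ℤ} :
    gridCell u h x = (i, (j : WithTop ℤ)) ↔ ∃ y : ℝ, x.2 = y ∧
      (u + i * h ≤ x.1 ∧ x.1 < u + (i + 1 : ℤ) * h) ∧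
        (u + j * h ≤ y ∧ y < u + (j + 1 : ℤ) * h) := by
  obtain ⟨x, y⟩ := x
  induction y using WithTop.recTopCoe with
  | top => simp [gridCell]
  | coe y =>
    rw [gridCell, Prod.mk.injEq, floor_grid_eq_iff hh, WithTop.map_coe, WithTop.coe_inj,
      floor_grid_eq_iff hh]
    simp [WithTop.coe_inj]

theorem gridCell_eq_top_iff {u h : ℝ} (hh : 0 < h) {x : ℝ × WithTop ℝ} {i : ℤ} :
    gridCell u h x = (i, ⊤) ↔ x.2 = ⊤ ∧ (u + i * h ≤ x.1 ∧ x.1 < u + (i + 1 : ℤ) * h) := by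
  obtain ⟨x, y⟩ := x
  rw [gridCell, Prod.mk.injEq, floor_grid_eq_iff hh, and_comm]
  simp

/-- The number of points of the diagram in a grid cell far from the diagonal. -/
theorem IsRankFunction.card_gridCell {ρ : ℝ → ℝ → ℕ} (hρ : IsRankFunction ρ) {u h : ℝ}
    (hh : 0 < h) (hreg : ∀ i : ℤ, IsRegularValue ρ (u + i * h)) {q : ℤ → ℤ → ℕ}
    (hq : IsRankFunction q) (hqρ : ∀ i j, i ≤ j → q i j = ρ (u + i * h) (u + j * h))
    {c : ℤ × WithTop ℤ} (hc : IsFarCell c) :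
    Finite {p : (rankDiagram ρ).Point // gridCell u h p.1 = c} ∧
      Nat.card {p : (rankDiagram ρ).Point // gridCell u h p.1 = c} = cellCount q c := by
  have hlt : ∀ {i j : ℤ}, i < j → u + i * h < u + j * h := fun hij => by
    have : (_ : ℝ) < _ := Int.cast_lt.2 hij
    nlinarith
  -- Grid values are regular, so no diagram point lies on a grid line, and the half-open cells cut
  -- out by the floor function contain the same points as the open rectangles.
  have hbirth : ∀ {x : ℝ} {y : WithTop ℝ} {i : ℤ}, rankDiagram ρ (x, y) ≠ 0 →
      u + i * h ≤ x → u + i * h < x := fun hx hle => hle.lt_of_ne fun h => by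
    subst h
    exact hx (hρ.rankDiagram_eq_zero_of_birth (hreg _) _)
  have hdeath : ∀ {x y : ℝ} {i : ℤ}, rankDiagram ρ (x, (y : WithTop ℝ)) ≠ 0 →
      u + i * h ≤ y → u + i * h < y := fun hx hle => hle.lt_of_ne fun h => by
    subst h
    exact hx (hρ.rankDiagram_eq_zero_of_death (hreg _))
  obtain ⟨i, j⟩ := c
  induction j using WithTop.recTopCoe with
  | top =>
    obtain ⟨T, hT1, hT2, hT3⟩ := hρ.exists_finset_sum_top (hlt (lt_add_one i)) (hreg i)
      (hreg (i + 1))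
    have key := finite_fiber_and_card (rankDiagram ρ) (gridCell u h) (i, ⊤)
      (T.map ⟨fun x => (x, (⊤ : WithTop ℝ)), by intro _ _ h; exact (Prod.mk.inj h).1⟩) ?_ ?_
    · refine ⟨key.1, key.2.trans ?_⟩
      rw [Finset.sum_map]
      have h4 : Tendsto (fun j : ℤ => u + j * h) atTop atTop :=
        tendsto_atTop_add_const_left _ _ (tendsto_intCast_atTop_atTop.atTop_mul_const hh)
      obtain ⟨j, ⟨h5, h6⟩, h7⟩ := (((h4.eventually hT3).and (hq.cellCount_top i)).and
        (eventually_ge_atTop (i + 1))).exists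
      rw [hqρ _ _ h7, hqρ _ _ (by omega), ← h5] at h6
      refine Nat.cast_injective (R := ℤ) ?_
      rw [Nat.cast_sum]
      exact h6.symm
    · intro x hx
      obtain ⟨z, hz, rfl⟩ := Finset.mem_map.1 hx
      exact (gridCell_eq_top_iff hh).2 ⟨rfl, (hT1 z hz).1.le, (hT1 z hz).2⟩
    · rintro ⟨x, y⟩ hx hxT
      obtain ⟨rfl, h1, h2⟩ := (gridCell_eq_top_iff hh).1 hx
      by_contra h3
      refine h3 (hT2 x ⟨hbirth h3 h1, h2⟩ fun h => hxT ?_)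
      exact Finset.mem_map.2 ⟨x, h, rfl⟩
  | coe j =>
    -- The rectangle count requires births to end strictly before deaths begin, that is `i + 1 < j`;
    -- this is the source of the `2` in `IsFarCell`.
    have hc' : i + 2 ≤ j := WithTop.coe_le_coe.1 hc
    obtain ⟨T, hT1, hT2, hT3⟩ := hρ.exists_finset_sum_rectangle (hlt (lt_add_one i))
      (hlt (show i + 1 < j by omega)) (hlt (lt_add_one j)) (hreg i) (hreg (i + 1)) (hreg j)
      (hreg (j + 1))
    have key := finite_fiber_and_card (rankDiagram ρ) (gridCell u h) (i, (j : WithTop ℤ))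
      (T.map ⟨fun x => (x.1, (x.2 : WithTop ℝ)), by
        intro _ _ h
        exact Prod.ext (Prod.mk.inj h).1 (WithTop.coe_inj.1 (Prod.mk.inj h).2)⟩) ?_ ?_
    · refine ⟨key.1, key.2.trans ?_⟩
      rw [Finset.sum_map]
      have h6 := hq.cellCount_coe (show i + 1 ≤ j by omega)
      rw [hqρ _ _ (show i + 1 ≤ j by omega), hqρ i j (by omega),
        hqρ (i + 1) (j + 1) (by omega), hqρ i (j + 1) (by omega), ← hT3] at h6
      refine Nat.cast_injective (R := ℤ) ?_
      rw [Nat.cast_sum]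
      exact h6.symm
    · intro x hx
      obtain ⟨z, hz, rfl⟩ := Finset.mem_map.1 hx
      obtain ⟨h1, h2⟩ := hT1 z hz
      exact (gridCell_eq_coe_iff hh).2 ⟨z.2, rfl, ⟨h1.1.le, h1.2⟩, h2.1.le, h2.2⟩
    · rintro ⟨x, y⟩ hx hxT
      obtain ⟨y, rfl, ⟨h1, h2⟩, h3, h4⟩ := (gridCell_eq_coe_iff hh).1 hx
      by_contra h5
      refine h5 (hT2 (x, y) ⟨hbirth h5 h1, h2⟩ ⟨hdeath h5 h3, h4⟩ fun h => hxT ?_)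
      exact Finset.mem_map.2 ⟨(x, y), h, rfl⟩

/-- The number of points in a coarse cell is the sum of those in the cells it consists of. -/
theorem IsRankFunction.card_coarseCell {p : ℤ → ℤ → ℕ} (hp : IsRankFunction p) (o : ℤ)
    (hq : IsRankFunction fun i j : ℤ => p (2 * i + o) (2 * j + o))
    {c : ℤ × WithTop ℤ} (hc : IsFarCell c) :
    Finite {x : Σ k, Fin (cellCount p k) // coarseCell o x.1 = c} ∧
      Nat.card {x : Σ k, Fin (cellCount p k) // coarseCell o x.1 = c} =
        cellCount (fun i j : ℤ => p (2 * i + o) (2 * j + o)) c := by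
  classical
  obtain ⟨i, j⟩ := c
  induction j using WithTop.recTopCoe with
  | top =>
    have key := finite_fiber_and_card (cellCount p) (coarseCell o) (i, ⊤)
      ({(2 * i + o, ⊤), (2 * i + o + 1, ⊤)}) ?_ ?_
    · refine ⟨key.1, key.2.trans ?_⟩
      rw [Finset.sum_pair (by simp)]
      have h4 : Tendsto (fun j : ℤ => 2 * j + o) atTop atTop := by
        refine tendsto_atTop.2 fun b => ?_
        filter_upwards [eventually_ge_atTop (b - o), eventually_ge_atTop 0] with j h1 h2
        omega
      obtain ⟨j, ⟨h5, h6⟩, h7⟩ := (((h4.eventually (hp.cellCount_top (2 * i + o))).and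
        (h4.eventually (hp.cellCount_top (2 * i + o + 1)))).and (hq.cellCount_top i)).exists
      have e1 : 2 * i + o + 1 + 1 = 2 * (i + 1) + o := by ring
      rw [e1] at h6
      have h8 : (cellCount (fun i j : ℤ => p (2 * i + o) (2 * j + o)) (i, ⊤) : ℤ) =
        p (2 * (i + 1) + o) (2 * j + o) - p (2 * i + o) (2 * j + o) := h7
      omega
    · intro x hx
      rw [Finset.mem_insert, Finset.mem_singleton] at hx
      rcases hx with rfl | rfl
      · exact Prod.ext (show (2 * i + o - o) / 2 = i by omega) rfl
      · exact Prod.ext (show (2 * i + o + 1 - o) / 2 = i by omega) rfl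
    · rintro ⟨k, l⟩ hx hxT
      obtain ⟨h1, h2⟩ := Prod.mk.inj hx
      rw [WithTop.map_eq_top_iff] at h2
      subst h2
      simp only [Finset.mem_insert, Finset.mem_singleton, Prod.mk.injEq, and_true, not_or] at hxT
      simp only at h1
      omega
  | coe j =>
    have hc' : i + 2 ≤ j := WithTop.coe_le_coe.1 hc
    -- A coarse cell consists of four fine ones. Adding their alternating sums cancels every rank
    -- except those at the four outer corners.
    have key := finite_fiber_and_card (cellCount p) (coarseCell o) (i, (j : WithTop ℤ))
      ({(2 * i + o, ((2 * j + o : ℤ) : WithTop ℤ)), (2 * i + o, ((2 * j + o + 1 : ℤ) : WithTop ℤ)),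
        (2 * i + o + 1, ((2 * j + o : ℤ) : WithTop ℤ)),
        (2 * i + o + 1, ((2 * j + o + 1 : ℤ) : WithTop ℤ))}) ?_ ?_
    · refine ⟨key.1, key.2.trans ?_⟩
      rw [Finset.sum_insert, Finset.sum_insert, Finset.sum_pair]
      · have h1 := hp.cellCount_coe (show 2 * i + o + 1 ≤ 2 * j + o by omega)
        have h2 := hp.cellCount_coe (show 2 * i + o + 1 ≤ 2 * j + o + 1 by omega)
        have h3 := hp.cellCount_coe (show 2 * i + o + 1 + 1 ≤ 2 * j + o by omega)
        have h4 := hp.cellCount_coe (show 2 * i + o + 1 + 1 ≤ 2 * j + o + 1 by omega)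
        have h5 : (cellCount (fun i j : ℤ => p (2 * i + o) (2 * j + o)) (i, (j : WithTop ℤ)) : ℤ) =
          p (2 * (i + 1) + o) (2 * j + o) - p (2 * i + o) (2 * j + o)
          - p (2 * (i + 1) + o) (2 * (j + 1) + o) + p (2 * i + o) (2 * (j + 1) + o) :=
            hq.cellCount_coe (show i + 1 ≤ j by omega)
        have e1 : 2 * i + o + 1 + 1 = 2 * (i + 1) + o := by ring
        have e2 : 2 * j + o + 1 + 1 = 2 * (j + 1) + o := by ring
        rw [e1] at h3 h4
        rw [e2] at h2 h4
        omega
      · intro h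
        simp only [Prod.mk.injEq, WithTop.coe_inj] at h
        omega
      · intro h
        simp only [Finset.mem_insert, Finset.mem_singleton, Prod.mk.injEq, WithTop.coe_inj] at h
        omega
      · intro h
        simp only [Finset.mem_insert, Finset.mem_singleton, Prod.mk.injEq, WithTop.coe_inj] at h
        omega
    · intro x hx
      simp only [Finset.mem_insert, Finset.mem_singleton] at hx
      have a1 : (2 * i + o - o) / 2 = i := by omega
      have a2 : (2 * i + o + 1 - o) / 2 = i := by omega
      have b1 : (2 * j + o - o) / 2 = j := by omega
      have b2 : (2 * j + o + 1 - o) / 2 = j := by omega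
      rcases hx with rfl | rfl | rfl | rfl
      · exact Prod.ext a1 (congrArg WithTop.some b1)
      · exact Prod.ext a1 (congrArg WithTop.some b2)
      · exact Prod.ext a2 (congrArg WithTop.some b1)
      · exact Prod.ext a2 (congrArg WithTop.some b2)
    · rintro ⟨k, l⟩ hx hxT
      obtain ⟨h1, h2⟩ := Prod.mk.inj hx
      induction l using WithTop.recTopCoe with
      | top => simp at h2
      | coe l =>
        simp only [WithTop.map_coe, WithTop.coe_inj] at h1 h2
        simp only [Finset.mem_insert, Finset.mem_singleton, Prod.mk.injEq, WithTop.coe_inj,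
          not_or] at hxT
        omega

/-- Over each far coarse cell both sides have as many elements as the alternating sum of ranks at
its corners, where `p` and `ρ` agree. Used with `o = 0` for one module and `o = 1` for the other, it
relates both diagrams to the same virtual points counted by `p`. -/
theorem IsRankFunction.exists_equiv_points {ρ : ℝ → ℝ → ℕ} (hρ : IsRankFunction ρ)
    {p : ℤ → ℤ → ℕ} (hp : IsRankFunction p) {t η : ℝ} (hη : 0 < η) (o : ℤ)
    (hreg : ∀ i : ℤ, IsRegularValue ρ (t + i * η))
    (hpρ : ∀ i j : ℤ, i ≤ j → p (2 * i + o) (2 * j + o) =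
      ρ (t + (2 * i + o : ℤ) * η) (t + (2 * j + o : ℤ) * η)) :
    ∃ e : {a : (rankDiagram ρ).Point // IsFarCell (gridCell (t + o * η) (2 * η) a.1)} ≃
        {x : Σ k, Fin (cellCount p k) // IsFarCell (coarseCell o x.1)},
      ∀ a, coarseCell o (e a).1.1 = gridCell (t + o * η) (2 * η) a.1.1 := by
  have hq : IsRankFunction fun i j : ℤ => p (2 * i + o) (2 * j + o) :=
    ⟨fun h1 h2 h3 => hp.mono (by omega) (by omega) (by omega),
      fun h1 h2 h3 => hp.frobenius (by omega) (by omega) (by omega)⟩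
  have e1 : ∀ i : ℤ, t + o * η + i * (2 * η) = t + (2 * i + o : ℤ) * η := fun i => by
    push_cast
    ring
  refine exists_equiv_of_card_fibers _ _ IsFarCell fun c hc => ?_
  obtain ⟨f1, c1⟩ := hρ.card_gridCell (u := t + o * η) (h := 2 * η) (by linarith)
    (fun i => by rw [e1]; exact hreg _) hq (fun i j hij => by rw [e1, e1]; exact hpρ i j hij) hc
  obtain ⟨f2, c2⟩ := hp.card_coarseCell o hq hc
  exact Finite.card_eq.1 (c1.trans c2.symm)

/-- The coarse interval containing the fine interval `k` starts at `k` or at `k - 1`, depending on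
the parity of `k - o`; the bounds cover both cases. -/
theorem mem_Ico_of_floor_eq {t η x : ℝ} (hη : 0 < η) {o k : ℤ}
    (h : ⌊(x - (t + o * η)) / (2 * η)⌋ = (k - o) / 2) :
    t + (k - 1) * η ≤ x ∧ x < t + (k + 2) * η := by
  obtain ⟨h1, h2⟩ := (floor_grid_eq_iff (by linarith)).1 h
  have h3 : (k : ℝ) - 1 ≤ 2 * ((k - o) / 2 : ℤ) + o := by
    exact_mod_cast (show k - 1 ≤ 2 * ((k - o) / 2) + o by omega)
  have h4 : 2 * (((k - o) / 2 : ℤ) : ℝ) + o ≤ k := by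
    exact_mod_cast (show 2 * ((k - o) / 2) + o ≤ k by omega)
  push_cast at h2
  constructor <;> nlinarith

/-- Failure to be far in the other grid forces `l ≤ k + 3`. With a birth at least `(k - 1)η` and a
death below `(l + 2)η`, both relative to `t`, the lifetime is less than `6η`, and half of it is the
distance to the diagonal. -/
theorem diagonalDist_le_of_not_isFarCell {t η : ℝ} (hη : 0 < η) {o o' : ℤ}
    {x : ℝ × WithTop ℝ} {k : ℤ × WithTop ℤ}
    (hx : coarseCell o k = gridCell (t + o * η) (2 * η) x)
    (hk : ¬ IsFarCell (coarseCell o' k)) : diagonalDist x ≤ ENNReal.ofReal (3 * η) := by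
  obtain ⟨k, l⟩ := k
  obtain ⟨x, y⟩ := x
  obtain ⟨h1, h2⟩ := Prod.mk.inj hx
  induction l using WithTop.recTopCoe with
  | top => exact absurd le_top hk
  | coe l =>
    induction y using WithTop.recTopCoe with
    | top => exact absurd h2 WithTop.coe_ne_top
    | coe y =>
      obtain ⟨a1, -⟩ := mem_Ico_of_floor_eq hη h1.symm
      obtain ⟨-, b2⟩ := mem_Ico_of_floor_eq hη (WithTop.coe_inj.1 h2).symm
      have h3 : ¬ ((k - o') / 2 + 2 ≤ (l - o') / 2) := fun h => hk (WithTop.coe_le_coe.2 h)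
      have h4 : (l : ℝ) ≤ k + 3 := by exact_mod_cast (show l ≤ k + 3 by omega)
      refine ENNReal.ofReal_le_ofReal ?_
      nlinarith

/-- Here the lifetime is less than two coarse widths, `4η`, so the bound holds with room to spare.
-/
theorem diagonalDist_le_of_not_isFarCell_gridCell {u η : ℝ} (hη : 0 < η)
    {x : ℝ × WithTop ℝ} (hx : ¬ IsFarCell (gridCell u (2 * η) x)) :
    diagonalDist x ≤ ENNReal.ofReal (3 * η) := by
  obtain ⟨x, y⟩ := x
  induction y using WithTop.recTopCoe with
  | top => exact absurd le_top hx
  | coe y =>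
    have h3 : ¬ (⌊(x - u) / (2 * η)⌋ + 2 ≤ ⌊(y - u) / (2 * η)⌋) := fun h =>
      hx (WithTop.coe_le_coe.2 h)
    obtain ⟨a1, -⟩ := (floor_grid_eq_iff (u := u) (x := x) (show 0 < 2 * η by linarith)).1 rfl
    obtain ⟨-, b1⟩ := (floor_grid_eq_iff (u := u) (x := y) (show 0 < 2 * η by linarith)).1 rfl
    have h4 : ((⌊(y - u) / (2 * η)⌋ + 1 : ℤ) : ℝ) ≤ ⌊(x - u) / (2 * η)⌋ + 2 := by
      exact_mod_cast (show ⌊(y - u) / (2 * η)⌋ + 1 ≤ ⌊(x - u) / (2 * η)⌋ + 2 by omega)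
    refine ENNReal.ofReal_le_ofReal ?_
    nlinarith

/-- In each finite coordinate both points lie in the same interval of length `3η`, from `(k - 1)η`
to `(k + 2)η` relative to `t`, whatever the two offsets are. -/
theorem pointDist_le_of_coarseCell {t η : ℝ} (hη : 0 < η) {o o' : ℤ}
    {x x' : ℝ × WithTop ℝ} {k : ℤ × WithTop ℤ}
    (hx : coarseCell o k = gridCell (t + o * η) (2 * η) x)
    (hx' : coarseCell o' k = gridCell (t + o' * η) (2 * η) x') :
    pointDist x x' ≤ ENNReal.ofReal (3 * η) := by
  have key : ∀ {a b : ℝ} {k : ℤ}, ⌊(a - (t + o * η)) / (2 * η)⌋ = (k - o) / 2 →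
      ⌊(b - (t + o' * η)) / (2 * η)⌋ = (k - o') / 2 → edist a b ≤ ENNReal.ofReal (3 * η) := by
    intro a b k ha hb
    obtain ⟨a1, a2⟩ := mem_Ico_of_floor_eq hη ha
    obtain ⟨b1, b2⟩ := mem_Ico_of_floor_eq hη hb
    rw [edist_dist, Real.dist_eq]
    refine ENNReal.ofReal_le_ofReal (abs_le.2 ⟨?_, ?_⟩) <;> nlinarith
  obtain ⟨k, l⟩ := k
  obtain ⟨x, y⟩ := x
  obtain ⟨x', y'⟩ := x'
  obtain ⟨h1, h2⟩ := Prod.mk.inj hx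
  obtain ⟨h1', h2'⟩ := Prod.mk.inj hx'
  induction l using WithTop.recTopCoe with
  | top =>
    obtain rfl : y = ⊤ := WithTop.map_eq_top_iff.1 h2.symm
    obtain rfl : y' = ⊤ := WithTop.map_eq_top_iff.1 h2'.symm
    exact key h1.symm h1'.symm
  | coe l =>
    induction y using WithTop.recTopCoe with
    | top => exact absurd h2 WithTop.coe_ne_top
    | coe y =>
      induction y' using WithTop.recTopCoe with
      | top => exact absurd h2' WithTop.coe_ne_top
      | coe y' =>
        exact max_le (key h1.symm h1'.symm)
          (key (WithTop.coe_inj.1 h2).symm (WithTop.coe_inj.1 h2').symm)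

/-- Weak stability: if the ranks of two persistence modules at the points of a regular grid
are interleaved in a sequence of ranks, then the bottleneck distance of the diagrams is at most
three times the step of the grid. -/
theorem IsRankFunction.bottleneckDist_le {ρ σ : ℝ → ℝ → ℕ} (hρ : IsRankFunction ρ)
    (hσ : IsRankFunction σ) {p : ℤ → ℤ → ℕ} (hp : IsRankFunction p) {t η : ℝ} (hη : 0 < η)
    (hregρ : ∀ i : ℤ, IsRegularValue ρ (t + i * η))
    (hregσ : ∀ i : ℤ, IsRegularValue σ (t + i * η))
    (hpρ : ∀ i j : ℤ, i ≤ j → p (2 * i + 0) (2 * j + 0) =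
      ρ (t + (2 * i + 0 : ℤ) * η) (t + (2 * j + 0 : ℤ) * η))
    (hpσ : ∀ i j : ℤ, i ≤ j → p (2 * i + 1) (2 * j + 1) =
      σ (t + (2 * i + 1 : ℤ) * η) (t + (2 * j + 1 : ℤ) * η)) :
    bottleneckDist (rankDiagram ρ) (rankDiagram σ) ≤ ENNReal.ofReal (3 * η) := by
  obtain ⟨e, he⟩ := hρ.exists_equiv_points hp hη 0 hregρ hpρ
  obtain ⟨e', he'⟩ := hσ.exists_equiv_points hp hη 1 hregσ hpσ
  -- Two points are matched when they correspond to the same virtual point of `p`.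
  let m : Set ((rankDiagram ρ).Point × (rankDiagram σ).Point) :=
    {x | ∃ h h', (e ⟨x.1, h⟩).1 = (e' ⟨x.2, h'⟩).1}
  have hm : IsPartialMatching m := by
    constructor
    · rintro a a' b ⟨h1, h2, h3⟩ ⟨h4, h5, h6⟩
      exact congrArg Subtype.val (e.injective (Subtype.ext (h3.trans h6.symm)))
    · rintro a b b' ⟨h1, h2, h3⟩ ⟨h4, h5, h6⟩
      exact congrArg Subtype.val (e'.injective (Subtype.ext (h3.symm.trans h6)))
  refine iInf₂_le_of_le m hm (sup_le (sup_le ?_ ?_) ?_)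
  · refine iSup₂_le fun x hx => ?_
    obtain ⟨h1, h2, h3⟩ := hx
    refine pointDist_le_of_coarseCell (o' := 1) hη (he ⟨x.1, h1⟩) ?_
    rw [h3]
    exact he' ⟨x.2, h2⟩
  · refine iSup₂_le fun a ha => ?_
    by_cases h : IsFarCell (gridCell (t + (0 : ℤ) * η) (2 * η) a.1)
    · refine diagonalDist_le_of_not_isFarCell (o' := 1) hη (he ⟨a, h⟩) fun h' => ?_
      refine ha (e'.symm ⟨_, h'⟩).1 ⟨h, (e'.symm ⟨_, h'⟩).2, ?_⟩
      rw [Subtype.coe_eta, Equiv.apply_symm_apply]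
    · exact diagonalDist_le_of_not_isFarCell_gridCell hη h
  · refine iSup₂_le fun a ha => ?_
    by_cases h : IsFarCell (gridCell (t + (1 : ℤ) * η) (2 * η) a.1)
    · refine diagonalDist_le_of_not_isFarCell (o' := 0) hη (he' ⟨a, h⟩) fun h' => ?_
      refine ha (e.symm ⟨_, h'⟩).1 ⟨(e.symm ⟨_, h'⟩).2, h, ?_⟩
      rw [Subtype.coe_eta, Equiv.apply_symm_apply]
    · exact diagonalDist_le_of_not_isFarCell_gridCell hη h

/-- A bad offset is a translate, by one of countably many grid vectors, of one of countably many
irregular values; the complement of a countable set of reals is nonempty. -/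
theorem exists_regular_grid {ρ σ : ℝ → ℝ → ℕ} (hρ : IsRankFunction ρ) (hσ : IsRankFunction σ)
    (η : ℝ) : ∃ t : ℝ, ∀ i : ℤ, IsRegularValue ρ (t + i * η) ∧ IsRegularValue σ (t + i * η) := by
  have h : (⋃ i : ℤ, (fun t : ℝ => t + i * η) ⁻¹'
      ({x | ¬ IsRegularValue ρ x} ∪ {x | ¬ IsRegularValue σ x})).Countable :=
    Set.countable_iUnion fun i =>
      (hρ.countable_not_isRegularValue.union hσ.countable_not_isRegularValue).preimage
        (add_left_injective _)
  obtain ⟨t, ht⟩ := (h.dense_compl ℝ).nonempty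
  refine ⟨t, fun i => ?_⟩
  simp only [Set.mem_compl_iff, Set.mem_iUnion, Set.mem_preimage, Set.mem_union,
    Set.mem_ofPred_eq, not_exists, not_or, not_not] at ht
  exact ht i

end MultiscaleMapper

namespace MultiscaleMapper

/-! ## Contiguous simplicial maps -/

section Tuples

variable (F : Type*) [Field F]

/-- The augmented boundary map on chains of arbitrary tuples. -/
noncomputable def tupleBoundary (B : Type*) (n : ℕ) :
    ((Fin (n + 1) → B) →₀ F) →ₗ[F] ((Fin n → B) →₀ F) :=
  Finsupp.linearCombination F fun t =>
    ∑ i : Fin (n + 1), Finsupp.single (fun j => t (i.succAbove j)) ((-1 : F) ^ (i : ℕ))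

/-- The cone with apex `a` over a chain of tuples. -/
noncomputable def tupleCone {B : Type*} (a : B) (n : ℕ) :
    ((Fin n → B) →₀ F) →ₗ[F] ((Fin (n + 1) → B) →₀ F) :=
  Finsupp.lmapDomain F F fun t => (Fin.cons a t : Fin (n + 1) → B)

/-- The map on chains of tuples induced by a map of vertices. -/
noncomputable def tupleMap {A B : Type*} (φ : A → B) (n : ℕ) :
    ((Fin n → A) →₀ F) →ₗ[F] ((Fin n → B) →₀ F) :=
  Finsupp.lmapDomain F F fun t j => φ (t j)

/-- The prism over a tuple. -/
noncomputable def tuplePrism {A B : Type*} (φ ψ : A → B) :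
    (n : ℕ) → (Fin n → A) → ((Fin (n + 1) → B) →₀ F)
  | 0, _ => 0
  | n + 1, t => tupleCone F (φ (t 0)) (n + 1)
      (Finsupp.single (fun j => ψ (t j)) 1 - tuplePrism φ ψ n (Fin.tail t))

/-- The prism operator between two maps of vertices. -/
noncomputable def tupleHomotopy {A B : Type*} (φ ψ : A → B) (n : ℕ) :
    ((Fin n → A) →₀ F) →ₗ[F] ((Fin (n + 1) → B) →₀ F) :=
  Finsupp.linearCombination F (tuplePrism F φ ψ n)

variable {F}

/-- Omitting the apex returns `x`; omitting any other entry gives the cone over a face, with its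
sign reversed because the position has moved by one. -/
theorem tupleBoundary_tupleCone {B : Type*} (a : B) (n : ℕ) (x : (Fin (n + 1) → B) →₀ F) :
    tupleBoundary F B (n + 1) (tupleCone F a (n + 1) x) =
      x - tupleCone F a n (tupleBoundary F B n x) := by
  induction x using Finsupp.induction_linear with
  | zero => simp
  | add x y hx hy =>
    simp only [map_add, hx, hy]
    abel
  | single t c =>
    simp only [tupleBoundary, tupleCone, Finsupp.lmapDomain_apply, Finsupp.mapDomain_single,
      Finsupp.linearCombination_single, map_smul, map_sum]
    rw [Fin.sum_univ_succ, smul_add, sub_eq_add_neg, ← smul_neg, ← Finset.sum_neg_distrib]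
    congr 1
    · simp
    · refine congrArg _ (Finset.sum_congr rfl fun i _ => ?_)
      rw [← Finsupp.single_neg]
      congr 1
      · funext j
        refine Fin.cases ?_ (fun j => ?_) j
        · simp
        · simp
      · simp [pow_succ]

theorem tupleBoundary_tupleCone_zero {B : Type*} (a : B) (x : (Fin 0 → B) →₀ F) :
    tupleBoundary F B 0 (tupleCone F a 0 x) = x := by
  induction x using Finsupp.induction_linear with
  | zero => simp
  | add x y hx hy => simp only [map_add, hx, hy]
  | single t c =>
    simp only [tupleBoundary, tupleCone, Finsupp.lmapDomain_apply, Finsupp.mapDomain_single,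
      Finsupp.linearCombination_single]
    simp

theorem tupleBoundary_tupleMap {A B : Type*} (φ : A → B) (n : ℕ) (x : (Fin (n + 1) → A) →₀ F) :
    tupleBoundary F B n (tupleMap F φ (n + 1) x) = tupleMap F φ n (tupleBoundary F A n x) := by
  induction x using Finsupp.induction_linear with
  | zero => simp
  | add x y hx hy => simp only [map_add, hx, hy]
  | single t c =>
    simp only [tupleBoundary, tupleMap, Finsupp.lmapDomain_apply, Finsupp.mapDomain_single,
      Finsupp.linearCombination_single, map_smul, map_sum]

theorem tupleMap_tupleCone {A B : Type*} (φ : A → B) (a : A) (n : ℕ) (x : (Fin n → A) →₀ F) :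
    tupleMap F φ (n + 1) (tupleCone F a n x) = tupleCone F (φ a) n (tupleMap F φ n x) := by
  induction x using Finsupp.induction_linear with
  | zero => simp
  | add x y hx hy => simp only [map_add, hx, hy]
  | single t c =>
    simp only [tupleCone, tupleMap, Finsupp.lmapDomain_apply, Finsupp.mapDomain_single]
    congr 1
    funext j
    refine Fin.cases ?_ (fun j => ?_) j <;> simp

/-- The linear extension of the recursion that defines the prism, with the first entry playing the
role of the apex. -/
theorem tupleHomotopy_tupleCone {A B : Type*} (φ ψ : A → B) (a : A) (n : ℕ)
    (x : (Fin n → A) →₀ F) :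
    tupleHomotopy F φ ψ (n + 1) (tupleCone F a n x) =
      tupleCone F (φ a) (n + 1)
        (tupleCone F (ψ a) n (tupleMap F ψ n x) - tupleHomotopy F φ ψ n x) := by
  rw [← tupleMap_tupleCone]
  induction x using Finsupp.induction_linear with
  | zero => simp
  | add x y hx hy =>
    simp only [map_add, map_sub] at hx hy ⊢
    rw [hx, hy]
    abel
  | single t c =>
    have hs : ∀ s : Fin (n + 1) → B, Finsupp.single s c = c • Finsupp.single s (1 : F) := by simp
    simp only [tupleHomotopy, tupleMap, Finsupp.linearCombination_single,
      tupleCone, Finsupp.lmapDomain_apply, Finsupp.mapDomain_single]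
    rw [tuplePrism, hs, ← smul_sub, Finsupp.mapDomain_smul]
    rfl

theorem tupleCone_single {B : Type*} (a : B) (n : ℕ) (t : Fin n → B) (c : F) :
    tupleCone F a n (Finsupp.single t c) = Finsupp.single (Fin.cons a t) c := by
  rw [tupleCone, Finsupp.lmapDomain_apply, Finsupp.mapDomain_single]

/-- Induction on the length. The prism over `t` is the cone from `φ (t 0)` over `ψ t` minus the
prism over the tail; the boundary formula for cones and the case of the tail reduce the claim to
cancellation of cones. -/
theorem tupleBoundary_tuplePrism {A B : Type*} (φ ψ : A → B) (n : ℕ) (t : Fin (n + 1) → A) :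
    tupleBoundary F B (n + 1) (tuplePrism F φ ψ (n + 1) t) =
      Finsupp.single (fun j => ψ (t j)) 1 - Finsupp.single (fun j => φ (t j)) 1 -
        tupleHomotopy F φ ψ n (tupleBoundary F A n (Finsupp.single t 1)) := by
  have cons_tail : ∀ {m : ℕ} (f : A → B) (t : Fin (m + 1) → A),
      Finsupp.single (fun j => f (t j)) (1 : F) =
        tupleCone F (f (t 0)) m (Finsupp.single (fun j => f (Fin.tail t j)) 1) := by
    intro m f t
    rw [tupleCone_single]
    congr 1
    funext j
    refine Fin.cases ?_ (fun j => ?_) j <;> simp [Fin.tail]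
  induction n with
  | zero =>
    rw [tuplePrism, tuplePrism, sub_zero, tupleBoundary_tupleCone, cons_tail ψ t,
      tupleBoundary_tupleCone_zero, cons_tail φ t]
    have h0 : ∀ x : (Fin 0 → A) →₀ F, tupleHomotopy F φ ψ 0 x = 0 := by
      intro x
      rw [tupleHomotopy, Finsupp.linearCombination_apply]
      simp [tuplePrism]
    rw [h0, sub_zero]
    have ht : (fun j => ψ (Fin.tail t j)) = fun j => φ (Fin.tail t j) := funext fun j => j.elim0
    rw [ht]
  | succ m ih =>
    rw [tuplePrism, tupleBoundary_tupleCone, map_sub, ih, cons_tail ψ t, tupleBoundary_tupleCone,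
      cons_tail φ t]
    have ht : Finsupp.single t (1 : F) =
      tupleCone F (t 0) (m + 1) (Finsupp.single (Fin.tail t) 1) := by
      rw [tupleCone_single, Fin.cons_self_tail]
    have hm : Finsupp.single (fun j => ψ (Fin.tail t j)) (1 : F) =
      tupleMap F ψ (m + 1) (Finsupp.single (Fin.tail t) 1) := by
      rw [tupleMap, Finsupp.lmapDomain_apply, Finsupp.mapDomain_single]
    have hp : tupleHomotopy F φ ψ (m + 1) (Finsupp.single (Fin.tail t) 1) =
      tuplePrism F φ ψ (m + 1) (Fin.tail t) := by
      rw [tupleHomotopy, Finsupp.linearCombination_single, one_smul]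
    rw [ht, tupleBoundary_tupleCone, map_sub (tupleHomotopy F φ ψ (m + 1)),
      tupleHomotopy_tupleCone, hp,
      ← tupleBoundary_tupleMap, ← hm]
    simp only [map_sub]
    abel

theorem tupleBoundary_tupleHomotopy {A B : Type*} (φ ψ : A → B) (n : ℕ)
    (x : (Fin (n + 1) → A) →₀ F) :
    tupleBoundary F B (n + 1) (tupleHomotopy F φ ψ (n + 1) x) =
      tupleMap F ψ (n + 1) x - tupleMap F φ (n + 1) x -
        tupleHomotopy F φ ψ n (tupleBoundary F A n x) := by
  induction x using Finsupp.induction_linear with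
  | zero => simp
  | add x y hx hy =>
    simp only [map_add, hx, hy]
    abel
  | single t c =>
    have hs : Finsupp.single t c = c • Finsupp.single t (1 : F) := by simp
    rw [hs]
    simp only [map_smul, ← smul_sub]
    congr 1
    have := tupleBoundary_tuplePrism (F := F) φ ψ n t
    simp only [tupleMap, Finsupp.lmapDomain_apply, Finsupp.mapDomain_single]
    rw [← this, tupleHomotopy, Finsupp.linearCombination_single, one_smul]

/-- The prism introduces no entries beyond the values of `φ` and `ψ` on the tuple. Contiguity makes
these values a simplex, so the prism operator stays inside the target complex. -/
theorem tuplePrism_mem_supported {A B : Type*} (φ ψ : A → B) (S : Set B) (n : ℕ)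
    (t : Fin n → A) (hφ : ∀ j, φ (t j) ∈ S) (hψ : ∀ j, ψ (t j) ∈ S) :
    tuplePrism F φ ψ n t ∈ Finsupp.supported F F {s : Fin (n + 1) → B | ∀ j, s j ∈ S} := by
  induction n with
  | zero => exact zero_mem _
  | succ n ih =>
    have h : Finsupp.single (fun j => ψ (t j)) 1 - tuplePrism F φ ψ n (Fin.tail t) ∈
        Finsupp.supported F F {s : Fin (n + 1) → B | ∀ j, s j ∈ S} :=
      sub_mem (Finsupp.single_mem_supported F _ hψ)
        (ih (Fin.tail t) (fun j => hφ j.succ) fun j => hψ j.succ)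
    have h2 := Submodule.mem_map_of_mem (f := tupleCone F (φ (t 0)) (n + 1)) h
    rw [tupleCone, Finsupp.lmapDomain_supported] at h2
    refine Finsupp.supported_mono ?_ h2
    rintro _ ⟨s, hs, rfl⟩ j
    exact Fin.cases (hφ 0) (fun j => by simpa using hs j) j

/-- The tuple of vertices of an ordered simplex. -/
def OrderedSimplex.toTuple {A : Type*} {K : PreAbstractSimplicialComplex A} {n : ℕ}
    (t : OrderedSimplex K n) : Fin (n + 1) → A := Subtype.val t

theorem OrderedSimplex.toTuple_injective {A : Type*} {K : PreAbstractSimplicialComplex A} {n : ℕ} :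
    Function.Injective (OrderedSimplex.toTuple (K := K) (n := n)) := Subtype.val_injective

/-- The ordered chains of a complex, as chains of tuples. -/
noncomputable def chainToTuple {A : Type*} (K : PreAbstractSimplicialComplex A) (n : ℕ) :
    Chain F K n →ₗ[F] ((Fin (n + 1) → A) →₀ F) :=
  Finsupp.lmapDomain F F OrderedSimplex.toTuple

theorem chainToTuple_single {A : Type*} (K : PreAbstractSimplicialComplex A) {n : ℕ}
    (t : OrderedSimplex K n) (c : F) :
    chainToTuple K n (Finsupp.single t c) = Finsupp.single t.toTuple c := by
  rw [chainToTuple, Finsupp.lmapDomain_apply, Finsupp.mapDomain_single]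

/-- Allows identities of chains to be checked among arbitrary tuples, where cones always exist even
if they do not in the complex. -/
theorem chainToTuple_injective {A : Type*} (K : PreAbstractSimplicialComplex A) (n : ℕ) :
    Function.Injective (chainToTuple (F := F) K n) :=
  Finsupp.mapDomain_injective OrderedSimplex.toTuple_injective

theorem chainToTuple_boundary {A : Type*} (K : PreAbstractSimplicialComplex A) (n : ℕ)
    (x : Chain F K (n + 1)) :
    chainToTuple K n (boundary F K n x) =
      tupleBoundary F A (n + 1) (chainToTuple K (n + 1) x) := by
  induction x using Finsupp.induction_linear with
  | zero => simp
  | add x y hx hy => simp only [map_add, hx, hy]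
  | single t c =>
    simp only [boundary, tupleBoundary, chainToTuple_single, Finsupp.linearCombination_single,
      map_smul, map_sum]
    rfl

theorem chainToTuple_chainMap {A B : Type*} {K : PreAbstractSimplicialComplex A}
    {L : PreAbstractSimplicialComplex B} {φ : A → B} (hφ : IsSimplicialMap K L φ) (n : ℕ)
    (x : Chain F K n) :
    chainToTuple L n (chainMap hφ n x) = tupleMap F φ (n + 1) (chainToTuple K n x) := by
  induction x using Finsupp.induction_linear with
  | zero => simp
  | add x y hx hy => simp only [map_add, hx, hy]
  | single t c =>
    simp only [chainMap, tupleMap, chainToTuple_single, Finsupp.lmapDomain_apply,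
      Finsupp.mapDomain_single]
    rfl

open Classical in
/-- Contiguous simplicial maps induce the same map on homology. -/
theorem homologyMap_eq_of_contiguous {A B : Type*} {K : PreAbstractSimplicialComplex A}
    {L : PreAbstractSimplicialComplex B} {φ ψ : A → B} (hφ : IsSimplicialMap K L φ)
    (hψ : IsSimplicialMap K L ψ) (h : ∀ σ ∈ K.faces, σ.image φ ∪ σ.image ψ ∈ L.faces) (n : ℕ) :
    homologyMap (F := F) hφ n = homologyMap hψ n := by
  refine LinearMap.ext fun x => ?_
  obtain ⟨⟨z, hz⟩, rfl⟩ := Submodule.Quotient.mk_surjective _ x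
  refine ((Submodule.Quotient.eq _).2 ?_).symm
  change chainMap hψ n z - chainMap hφ n z ∈ LinearMap.range (boundary F L n)
  have hmem : ∀ z : Chain F K n, tupleHomotopy F φ ψ (n + 1) (chainToTuple K n z) ∈
      LinearMap.range (chainToTuple (F := F) L (n + 1)) := by
    intro z
    induction z using Finsupp.induction_linear with
    | zero => simp
    | add x y hx hy =>
      rw [map_add, map_add]
      exact add_mem hx hy
    | single t c =>
      rw [chainToTuple_single, tupleHomotopy, Finsupp.linearCombination_single]
      refine Submodule.smul_mem _ _ ?_
      have h1 := tuplePrism_mem_supported (F := F) φ ψ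
        (((Finset.univ.image t.toTuple).image φ ∪ (Finset.univ.image t.toTuple).image ψ :
          Finset B) : Set B) (n + 1) t.toTuple (fun j => by simp) (fun j => by simp)
      have h2 : LinearMap.range (chainToTuple (F := F) L (n + 1)) =
          Finsupp.supported F F (Set.range (OrderedSimplex.toTuple (K := L) (n := n + 1))) := by
        rw [chainToTuple, ← Set.image_univ, ← Finsupp.lmapDomain_supported, Finsupp.supported_univ,
          LinearMap.range_eq_map]
      rw [h2]
      refine Finsupp.supported_mono (fun s hs => ?_) h1
      refine ⟨⟨s, (L.isRelLowerSet_faces (h _ t.2)).2 (fun b hb => ?_)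
        (Finset.univ_nonempty.image _)⟩, rfl⟩
      obtain ⟨j, -, rfl⟩ := Finset.mem_image.1 hb
      exact hs j
  obtain ⟨w, hw⟩ := hmem z
  -- In degree `0` the tuple boundary is the augmentation and need not vanish on `z`, but the prism
  -- over the empty tuple is `0`. In positive degree `z` is a cycle.
  have hzero : tupleHomotopy F φ ψ n (tupleBoundary F A n (chainToTuple K n z)) = 0 := by
    cases n with
    | zero =>
      rw [tupleHomotopy, Finsupp.linearCombination_apply]
      simp [tuplePrism]
    | succ n =>
      have hz' : boundary F K n z = 0 := hz
      rw [← chainToTuple_boundary, hz', map_zero, map_zero]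
  refine ⟨w, chainToTuple_injective (F := F) L n ?_⟩
  rw [chainToTuple_boundary, hw, tupleBoundary_tupleHomotopy, hzero, sub_zero, map_sub,
    chainToTuple_chainMap, chainToTuple_chainMap]

end Tuples
end MultiscaleMapper

namespace MultiscaleMapper

open CategoryTheory

/-! ## Refinement of families of sets -/

/-- An indexed family of subsets of `E`. -/
structure SetFamily.{u, v} (E : Type v) where
  /-- the index set -/
  Idx : Type u
  /-- the members of the family -/
  carrier : Idx → Set E

/-- Families are preordered by refinement. -/
instance {E : Type*} : Preorder (SetFamily E) where
  le U U' := ∀ a, ∃ b, U.carrier a ⊆ U'.carrier b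
  le_refl U a := ⟨a, subset_rfl⟩
  le_trans U U' U'' h h' a := by
    obtain ⟨b, hb⟩ := h a
    obtain ⟨c, hc⟩ := h' b
    exact ⟨c, hb.trans hc⟩

theorem isSimplicialMap_nerve {A B E : Type*} {U : A → Set E} {U' : B → Set E} {φ : A → B}
    (h : ∀ a, U a ⊆ U' (φ a)) : IsSimplicialMap (nerve U) (nerve U') φ := by
  classical
  rintro σ ⟨hσ, x, hx⟩
  refine ⟨hσ.image _, x, ?_⟩
  simp only [Set.mem_iInter, Finset.mem_image] at hx ⊢
  rintro _ ⟨a, ha, rfl⟩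
  exact h a (hx a ha)

/-- A common point of the sets `U a` lies in every `U' (φ a)` and every `U' (ψ a)`, so the two maps
are contiguous. -/
theorem homologyMap_nerve_eq {F : Type*} [Field F] {A B E : Type*} {U : A → Set E}
    {U' : B → Set E} {φ ψ : A → B} (hφ : ∀ a, U a ⊆ U' (φ a)) (hψ : ∀ a, U a ⊆ U' (ψ a))
    (hφ' : IsSimplicialMap (nerve U) (nerve U') φ) (hψ' : IsSimplicialMap (nerve U) (nerve U') ψ)
    (k : ℕ) : homologyMap (F := F) hφ' k = homologyMap hψ' k := by
  classical
  refine homologyMap_eq_of_contiguous hφ' hψ' ?_ k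
  rintro σ ⟨hσ, x, hx⟩
  refine ⟨(hσ.image _).mono Finset.subset_union_left, x, ?_⟩
  simp only [Set.mem_iInter, Finset.mem_union, Finset.mem_image] at hx ⊢
  rintro _ (⟨a, ha, rfl⟩ | ⟨a, ha, rfl⟩)
  · exact hφ a (hx a ha)
  · exact hψ a (hx a ha)

namespace SetFamily

variable (F : Type*) [Field F] {E : Type*}

/-- The map on the homology of nerves induced by a refinement. -/
noncomputable def refineMap {U U' : SetFamily E} (h : U ≤ U') (k : ℕ) :
    Homology F (nerve U.carrier) k →ₗ[F] Homology F (nerve U'.carrier) k :=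
  homologyMap (isSimplicialMap_nerve fun a => (h a).choose_spec) k

/-- The composite of the chosen index maps need not be the index map chosen for `U ≤ U''`, but both
realize this refinement, so they agree in homology. -/
theorem refineMap_comp {U U' U'' : SetFamily E} (h : U ≤ U') (h' : U' ≤ U'') (k : ℕ) :
    refineMap F h' k ∘ₗ refineMap F h k = refineMap F (h.trans h') k := by
  have hs : ∀ a, U.carrier a ⊆ U''.carrier (h' (h a).choose).choose := fun a =>
    (h a).choose_spec.trans (h' (h a).choose).choose_spec
  rw [refineMap, refineMap, homologyMap_comp _ _ (isSimplicialMap_nerve hs) (fun _ => rfl)]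
  exact homologyMap_nerve_eq hs (fun a => ((h.trans h') a).choose_spec) _ _ k

open Classical in
/-- The rank of the map on homology induced by a refinement. -/
noncomputable def refineRank (k : ℕ) (U U' : SetFamily E) : ℕ :=
  if h : U ≤ U' then Module.finrank F (LinearMap.range (refineMap F h k)) else 0

instance finite_homology {A : Type*} [Finite A] (K : PreAbstractSimplicialComplex A) (k : ℕ) :
    Module.Finite F (Homology F K k) := by
  have : Finite (OrderedSimplex K k) := Subtype.finite
  infer_instance

end SetFamily

/-- Applying `h` to a subspace `R` loses dimension `dim (R ⊓ ker h)`, which increases with `R`;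
compare the range of `g ∘ₗ f` with that of `g`. This is the source of `IsRankFunction.frobenius`. -/
theorem finrank_range_comp_add_le {F A B C D : Type*} [Field F] [AddCommGroup A] [Module F A]
    [AddCommGroup B] [Module F B] [AddCommGroup C] [Module F C] [AddCommGroup D] [Module F D]
    [Module.Finite F C] (f : A →ₗ[F] B) (g : B →ₗ[F] C) (h : C →ₗ[F] D) :
    Module.finrank F (LinearMap.range (g ∘ₗ f)) + Module.finrank F (LinearMap.range (h ∘ₗ g)) ≤
      Module.finrank F (LinearMap.range g) + Module.finrank F (LinearMap.range (h ∘ₗ g ∘ₗ f)) := by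
  have key : ∀ R : Submodule F C, Module.finrank F (R.map h) +
      Module.finrank F (R ⊓ LinearMap.ker h : Submodule F C) = Module.finrank F R := by
    intro R
    rw [← LinearMap.finrank_range_add_finrank_ker (h.domRestrict R), LinearMap.range_domRestrict,
      LinearMap.ker_domRestrict, ← Submodule.map_comap_subtype, Submodule.finrank_map_subtype_eq]
  have h1 := key (LinearMap.range g)
  have h2 := key (LinearMap.range (g ∘ₗ f))
  have h3 : Module.finrank F (LinearMap.range (g ∘ₗ f) ⊓ LinearMap.ker h : Submodule F C) ≤
      Module.finrank F (LinearMap.range g ⊓ LinearMap.ker h : Submodule F C) :=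
    Submodule.finrank_mono (inf_le_inf_right _ (LinearMap.range_comp_le_range f g))
  rw [← LinearMap.range_comp] at h1 h2
  omega

namespace SetFamily

variable (F : Type*) [Field F] {E : Type*}

theorem refineRank_mono (k : ℕ) {U' U V V' : SetFamily E} [Finite U.Idx] [Finite V.Idx]
    (h1 : U' ≤ U) (h2 : U ≤ V) (h3 : V ≤ V') : refineRank F k U' V' ≤ refineRank F k U V := by
  rw [refineRank, refineRank, dif_pos h2, dif_pos ((h1.trans h2).trans h3),
    ← refineMap_comp F (h1.trans h2) h3, ← refineMap_comp F h1 h2]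
  rw [LinearMap.range_comp]
  refine (Submodule.finrank_map_le _ _).trans ?_
  exact Submodule.finrank_mono (LinearMap.range_comp_le_range _ _)

theorem refineRank_frobenius (k : ℕ) {U V W X : SetFamily E} [Finite W.Idx]
    (h1 : U ≤ V) (h2 : V ≤ W) (h3 : W ≤ X) :
    refineRank F k U W + refineRank F k V X ≤ refineRank F k V W + refineRank F k U X := by
  rw [refineRank, refineRank, refineRank, refineRank, dif_pos h2, dif_pos (h1.trans h2),
    dif_pos (h2.trans h3), dif_pos ((h1.trans h2).trans h3),
    ← refineMap_comp F (h1.trans h2) h3, ← refineMap_comp F h1 h2, ← refineMap_comp F h2 h3]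
  exact finrank_range_comp_add_le _ _ _

theorem isRankFunction_refineRank {T : Type*} [Preorder T] {G : T → SetFamily E}
    (hG : Monotone G) (hfin : ∀ t, Finite (G t).Idx) (k : ℕ) :
    IsRankFunction fun a b => refineRank F k (G a) (G b) where
  mono h1 h2 h3 := by
    have := hfin
    exact refineRank_mono F k (hG h1) (hG h2) (hG h3)
  frobenius h1 h2 h3 := by
    have := hfin
    exact refineRank_frobenius F k (hG h1) (hG h2) (hG h3)

end SetFamily

/-! ## Towers as monotone families -/

open Classical in
/-- The family at scale `t` of a tower, pulled back along `p`; it is empty below the resolution. -/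
noncomputable def SetTower.familyAt.{u, v, w} {X : Type v} {E : Type w} {r : ℝ}
    (S : SetTower.{u, v} X r) (p : E → X) (t : ℝ) : SetFamily.{u, w} E :=
  if h : r ≤ t then ⟨S.Idx ⟨t, h⟩, fun a => p ⁻¹' S.carrier ⟨t, h⟩ a⟩ else ⟨PEmpty, fun _ => ∅⟩

theorem SetTower.familyAt_of_le {X E : Type*} {r : ℝ} (S : SetTower X r) (p : E → X) {t : ℝ}
    (h : r ≤ t) :
    S.familyAt p t = ⟨S.Idx ⟨t, h⟩, fun a => p ⁻¹' S.carrier ⟨t, h⟩ a⟩ := dif_pos h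

theorem SetTower.familyAt_of_not_le {X E : Type*} {r : ℝ} (S : SetTower X r) (p : E → X) {t : ℝ}
    (h : ¬ r ≤ t) : S.familyAt p t = ⟨PEmpty, fun _ => ∅⟩ := dif_neg h

theorem SetTower.monotone_familyAt {X E : Type*} {r : ℝ} (S : SetTower X r) (p : E → X) :
    Monotone (S.familyAt p) := by
  intro t t' h
  by_cases ht : r ≤ t
  · rw [S.familyAt_of_le p ht, S.familyAt_of_le p (ht.trans h)]
    exact fun a => ⟨S.map h a, Set.preimage_mono (S.subset_map (ε' := ⟨t', ht.trans h⟩) h a)⟩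
  · rw [S.familyAt_of_not_le p ht]
    exact fun a => a.elim

theorem SetTower.finite_familyAt {X E : Type*} {r : ℝ} {S : SetTower X r} (hS : S.IsFinite)
    (p : E → X) (t : ℝ) : Finite (S.familyAt p t).Idx := by
  by_cases ht : r ≤ t
  · rw [S.familyAt_of_le p ht]
    exact hS _
  · rw [S.familyAt_of_not_le p ht]
    exact inferInstanceAs (Finite PEmpty)

/-- A common point of the sets `U a` lifts through the surjection to a common point of their
preimages. -/
theorem nerve_preimage {A X E : Type*} (U : A → Set X) {p : E → X} (hp : Function.Surjective p) :
    nerve (fun a => p ⁻¹' U a) = nerve U := by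
  have h : ∀ σ : Finset A, (⋂ a ∈ σ, p ⁻¹' U a).Nonempty ↔ (⋂ a ∈ σ, U a).Nonempty := by
    intro σ
    rw [← Set.preimage_iInter₂, hp.nonempty_preimage]
  refine PreAbstractSimplicialComplex.ext ?_
  exact Set.ext fun σ => and_congr_right fun _ => h σ

theorem finrank_range_homologyMap_congr (F : Type*) [Field F] {A B : Type*}
    {K K' : PreAbstractSimplicialComplex A} {L L' : PreAbstractSimplicialComplex B} {φ : A → B}
    (hK : K = K') (hL : L = L') (hφ : IsSimplicialMap K L φ) (hφ' : IsSimplicialMap K' L' φ)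
    (k : ℕ) : Module.finrank F (LinearMap.range (homologyMap (F := F) hφ k)) =
      Module.finrank F (LinearMap.range (homologyMap (F := F) hφ' k)) := by
  subst hK hL
  rfl

/-- The structure map of the tower is one index map realizing the refinement, hence induces the
canonical map. Below the resolution the empty family has no simplices, in agreement with the
extension of `rank` by zero. -/
theorem SetTower.rank_nerveTower_homology {X E : Type*} {r : ℝ} (S : SetTower X r) {p : E → X}
    (hp : Function.Surjective p) (F : Type*) [Field F] (k : ℕ) {a b : ℝ} (hab : a ≤ b) :
    rank (S.nerveTower.homology F k) a b =
      SetFamily.refineRank F k (S.familyAt p a) (S.familyAt p b) := by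
  by_cases ha : r ≤ a
  · have hle := S.monotone_familyAt p hab
    rw [S.familyAt_of_le p ha, S.familyAt_of_le p (ha.trans hab)] at hle ⊢
    rw [rank, dif_pos ⟨ha, hab⟩, SetFamily.refineRank, dif_pos hle]
    have hs : ∀ α, p ⁻¹' S.carrier ⟨a, ha⟩ α ⊆
        p ⁻¹' S.carrier ⟨b, ha.trans hab⟩ (S.map hab α) := fun α =>
      Set.preimage_mono (S.subset_map (ε' := ⟨b, ha.trans hab⟩) hab α)
    have h1 : SetFamily.refineMap F hle k = homologyMap
        (isSimplicialMap_nerve (U' := fun β => p ⁻¹' S.carrier ⟨b, ha.trans hab⟩ β) hs) k :=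
      homologyMap_nerve_eq (fun a => (hle a).choose_spec) hs _ _ k
    rw [h1]
    exact finrank_range_homologyMap_congr F (nerve_preimage _ hp).symm (nerve_preimage _ hp).symm
      _ _ k
  · rw [rank, dif_neg fun h => ha h.1, SetFamily.refineRank, dif_pos (S.monotone_familyAt p hab)]
    have h0 : Subsingleton (Homology F (nerve (S.familyAt p a).carrier) k) := by
      rw [S.familyAt_of_not_le p ha]
      have : IsEmpty (OrderedSimplex (nerve fun _ : PEmpty => (∅ : Set E)) k) :=
        ⟨fun t => (t.1 0).elim⟩
      infer_instance
    have h1 : SetFamily.refineMap F (S.monotone_familyAt p hab) k = 0 :=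
      LinearMap.ext fun x => by rw [Subsingleton.elim x 0, map_zero, map_zero]
    rw [h1, LinearMap.range_zero, finrank_bot]

theorem SetTower.isRankFunction_rank {X E : Type*} {r : ℝ} {S : SetTower X r} (hS : S.IsFinite)
    {p : E → X} (hp : Function.Surjective p) (F : Type*) [Field F] (k : ℕ) :
    IsRankFunction (rank (S.nerveTower.homology F k)) := by
  have h := SetFamily.isRankFunction_refineRank F (S.monotone_familyAt p)
    (S.finite_familyAt hS p) k
  constructor
  · intro a' a b b' h1 h2 h3
    rw [S.rank_nerveTower_homology hp F k h2,
      S.rank_nerveTower_homology hp F k ((h1.trans h2).trans h3)]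
    exact h.mono h1 h2 h3
  · intro a b c d h1 h2 h3
    rw [S.rank_nerveTower_homology hp F k h2, S.rank_nerveTower_homology hp F k (h1.trans h2),
      S.rank_nerveTower_homology hp F k (h2.trans h3),
      S.rank_nerveTower_homology hp F k ((h1.trans h2).trans h3)]
    exact h.frobenius h1 h2 h3

/-- If two towers of families refine each other up to a shift by `η`, after pulling them back to
a common set, then the diagrams of their nerves are close. -/
theorem bottleneckDist_le_of_familyAt_le.{u, v, v', w} {X : Type v} {Y : Type v'} {E : Type w}
    {r : ℝ} {S : SetTower.{u, v} X r} {T : SetTower.{u, v'} Y r} (hS : S.IsFinite)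
    (hT : T.IsFinite) {p : E → X} {q : E → Y} (hp : Function.Surjective p)
    (hq : Function.Surjective q) {η : ℝ} (hη : 0 < η)
    (hST : ∀ t, S.familyAt p t ≤ T.familyAt q (t + η))
    (hTS : ∀ t, T.familyAt q t ≤ S.familyAt p (t + η)) (F : Type*) [Field F] (k : ℕ) :
    bottleneckDist (diagram (S.nerveTower.homology F k)) (diagram (T.nerveTower.homology F k)) ≤
      ENNReal.ofReal (3 * η) := by
  have h1 := S.isRankFunction_rank hS hp F k
  have h2 := T.isRankFunction_rank hT hq F k
  obtain ⟨t, ht⟩ := exists_regular_grid h1 h2 η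
  -- The two hypotheses of mutual refinement are exactly what makes this alternating sequence
  -- monotone; its mixed ranks link the two modules.
  let G : ℤ → SetFamily.{u, w} E := fun i =>
    if Even i then S.familyAt p (t + i * η) else T.familyAt q (t + i * η)
  have hG : Monotone G := by
    refine monotone_int_of_le_succ fun i => ?_
    have e : t + ((i + 1 : ℤ) : ℝ) * η = t + i * η + η := by
      push_cast
      ring
    by_cases hi : Even i
    · have hi' : ¬ Even (i + 1) := by simpa [Int.even_add_one] using hi
      simp only [G, if_pos hi, if_neg hi', e]
      exact hST _
    · have hi' : Even (i + 1) := by simpa [Int.even_add_one] using hi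
      simp only [G, if_neg hi, if_pos hi', e]
      exact hTS _
  have hfin : ∀ i, Finite (G i).Idx := by
    intro i
    by_cases hi : Even i
    · simp only [G, if_pos hi]
      exact S.finite_familyAt hS p _
    · simp only [G, if_neg hi]
      exact T.finite_familyAt hT q _
  have hle : ∀ i j : ℤ, i ≤ j → ∀ o : ℤ,
      t + (2 * i + o : ℤ) * η ≤ t + (2 * j + o : ℤ) * η := fun i j hij o => by
    have : ((2 * i + o : ℤ) : ℝ) ≤ (2 * j + o : ℤ) := Int.cast_le.2 (by omega)
    nlinarith
  rw [diagram_eq_rankDiagram, diagram_eq_rankDiagram]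
  refine h1.bottleneckDist_le h2 (SetFamily.isRankFunction_refineRank F hG hfin k) hη
    (fun i => (ht i).1) (fun i => (ht i).2) (fun i j hij => ?_) (fun i j hij => ?_)
  · rw [S.rank_nerveTower_homology hp F k (hle i j hij 0)]
    have e : ∀ i : ℤ, Even (2 * i + 0) := fun i => by simp
    simp only [G, if_pos (e _)]
  · rw [T.rank_nerveTower_homology hq F k (hle i j hij 1)]
    have e : ∀ i : ℤ, ¬ Even (2 * i + 1) := fun i => by simp
    simp only [G, if_neg (e _)]

end MultiscaleMapper

/-! ## Simplices and coordinates of the realization -/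

namespace AbstractSimplicialComplex

variable {V : Type*} (K : AbstractSimplicialComplex V)

theorem continuous_simplexInclusion (σ : K.faces) : Continuous (K.simplexInclusion σ) :=
  continuous_iff_coinduced_le.2
    (le_iSup (fun σ : K.faces => TopologicalSpace.coinduced (K.simplexInclusion σ) inferInstance) σ)

/-- For the final topology continuity may be checked on each closed simplex. Its use is that a
vertex of the carrier of a point remains in the carriers of all nearby points. -/
theorem continuous_coordinate (v : V) : Continuous fun x : K.Realization => x.1 v := by
  classical
  refine continuous_iSup_dom.2 fun σ => continuous_coinduced_dom.2 ?_
  by_cases h : v ∈ σ.1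
  · have : (fun x : K.Realization => x.1 v) ∘ K.simplexInclusion σ = fun y => y.1 ⟨v, h⟩ := by
      funext y
      simp [simplexInclusion, h]
    rw [this]
    exact (continuous_apply _).comp continuous_subtype_val
  · have : (fun x : K.Realization => x.1 v) ∘ K.simplexInclusion σ = fun _ => 0 := by
      funext y
      simp [simplexInclusion, h]
    rw [this]
    exact continuous_const

theorem isPathConnected_closedSimplex {σ : Finset V} (hσ : σ ∈ K.faces) :
    IsPathConnected (K.closedSimplex σ) := by
  classical
  have hne : σ.Nonempty := (K.isRelLowerSet_faces hσ).1
  have hrange : K.closedSimplex σ = Set.range (K.simplexInclusion ⟨σ, hσ⟩) := by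
    ext x
    constructor
    · intro hx
      have hx' : x.1.support ⊆ σ := hx
      refine ⟨⟨fun v => x.1 v, fun v => x.2.1 v, ?_⟩, ?_⟩
      · refine Eq.trans ?_ x.2.2.1
        rw [Finsupp.sum_of_support_subset _ hx' _ (fun _ _ => rfl)]
        exact Finset.sum_coe_sort σ fun v => x.1 v
      · refine Subtype.ext (Finsupp.ext fun v => ?_)
        by_cases h : v ∈ σ
        · simp [simplexInclusion, h]
        · have : x.1 v = 0 := Finsupp.notMem_support_iff.1 fun h' => h (hx' h')
          simp [simplexInclusion, h, this]
    · rintro ⟨y, rfl⟩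
      intro v hv
      by_contra h
      exact Finsupp.mem_support_iff.1 hv (by simp [simplexInclusion, h])
  have : Nonempty {v // v ∈ σ} := hne.to_subtype
  have : PathConnectedSpace (stdSimplex ℝ {v // v ∈ σ}) :=
    isPathConnected_iff_pathConnectedSpace.1 ((convex_stdSimplex ℝ _).isPathConnected
      ⟨_, single_mem_stdSimplex ℝ (Classical.arbitrary {v // v ∈ σ})⟩)
  rw [hrange]
  exact isPathConnected_range (K.continuous_simplexInclusion _)

theorem support_mem_faces (x : K.Realization) : x.1.support ∈ K.faces := x.2.2.2

theorem vertexPoint_mem_closedSimplex {σ : Finset V} {v : V} (hv : v ∈ σ) :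
    K.vertexPoint v ∈ K.closedSimplex σ := by
  change (Finsupp.single v (1 : ℝ)).support ⊆ σ
  rw [Finsupp.support_single v one_ne_zero]
  exact Finset.singleton_subset_iff.2 hv

theorem mem_closedSimplex_support (x : K.Realization) : x ∈ K.closedSimplex x.1.support :=
  Finset.Subset.refl _

theorem oneSkeletonGraph_adj {σ : Finset V} (hσ : σ ∈ K.faces) {u v : V} (hu : u ∈ σ)
    (hv : v ∈ σ) (h : u ≠ v) : K.oneSkeletonGraph.Adj u v := by
  classical
  refine ⟨h, ?_⟩
  convert (K.isRelLowerSet_faces hσ).2 (Finset.insert_subset hu (Finset.singleton_subset_iff.2 hv))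
    (Finset.insert_nonempty u {v})

/-! ### The common set over `|K|` and the vertex set -/

/-- The points of `|K|` together with a vertex of their carrier. -/
def PointedRealization : Type _ := {e : V × K.Realization // e.1 ∈ e.2.1.support}

/-- The vertex of a point with a chosen vertex. -/
def PointedRealization.vertex {K : AbstractSimplicialComplex V} (e : K.PointedRealization) : V :=
  e.1.1

/-- The underlying point of a point with a chosen vertex. -/
def PointedRealization.point {K : AbstractSimplicialComplex V} (e : K.PointedRealization) :
    K.Realization := e.1.2

theorem PointedRealization.vertex_mem {K : AbstractSimplicialComplex V}
    (e : K.PointedRealization) : e.vertex ∈ e.point.1.support := e.2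

theorem PointedRealization.vertex_surjective {K : AbstractSimplicialComplex V} :
    Function.Surjective (PointedRealization.vertex (K := K)) := fun v =>
  ⟨⟨(v, K.vertexPoint v), by
    change v ∈ (Finsupp.single v (1 : ℝ)).support
    rw [Finsupp.support_single v one_ne_zero]
    exact Finset.mem_singleton_self v⟩, rfl⟩

theorem support_nonempty (x : K.Realization) : x.1.support.Nonempty :=
  (K.isRelLowerSet_faces (K.support_mem_faces x)).1

theorem PointedRealization.point_surjective {K : AbstractSimplicialComplex V} :
    Function.Surjective (PointedRealization.point (K := K)) := fun x => by
  obtain ⟨v, hv⟩ := K.support_nonempty x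
  exact ⟨⟨(v, x), hv⟩, rfl⟩

end AbstractSimplicialComplex

namespace MultiscaleMapper

open Filter Topology

/-! ## Enlarging the members of a good tower -/

/-- Goodness speaks only of sets of diameter at least `s`. A smaller `O` is first enlarged to a
closed ball of radius `s` about one of its points, and the member found at scale `c * diam O'` is
moved up the tower to scale `c * D`. -/
theorem SetTower.IsGood.exists_subset {Z : Type*} [MetricSpace Z] [ConnectedSpace Z] {c s : ℝ}
    {W : SetTower Z s} (hW : W.IsGood c) {O : Set Z} (hO : O.Nonempty)
    (hOb : Bornology.IsBounded O) {D : ℝ} (hD : Metric.diam O ≤ D) (hsD : 2 * s ≤ D)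
    {ε : Set.Ici s} (hε : (ε : ℝ) = c * D) : ∃ α : W.Idx ε, O ⊆ W.carrier ε α := by
  have hs := hW.pos
  have hc := hW.one_le
  obtain ⟨O', hOO', h1, h2⟩ : ∃ O', O ⊆ O' ∧ s ≤ Metric.diam O' ∧ Metric.diam O' ≤ D := by
    rcases le_or_gt s (Metric.diam O) with h | h
    · exact ⟨O, subset_rfl, h, hD⟩
    obtain ⟨x, hx⟩ := hO
    refine ⟨Metric.closedBall x s, fun y hy => ?_, ?_, (Metric.diam_closedBall hs.le).trans hsD⟩
    · exact (Metric.dist_le_diam_of_mem hOb hy hx).trans h.le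
    -- By connectedness of `Z` the ball is everything, of diameter at least `s`, or some point lies
    -- at distance exactly `s` from `x`.
    · by_cases hu : Metric.closedBall x s = Set.univ
      · rw [hu]
        exact hW.le_diam
      obtain ⟨y, hy⟩ := (Set.ne_univ_iff_exists_notMem _).1 hu
      rw [Metric.mem_closedBall, not_le] at hy
      obtain ⟨z, hz⟩ := mem_range_of_exists_le_of_exists_ge (f := fun z => dist z x) (c := s)
        (continuous_id.dist continuous_const) ⟨x, by simpa using hs.le⟩ ⟨y, hy.le⟩
      have hz' : dist z x = s := hz
      rw [← hz']
      exact Metric.dist_le_diam_of_mem Metric.isBounded_closedBall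
        (Metric.mem_closedBall.2 le_rfl) (Metric.mem_closedBall_self dist_nonneg)
  have h3 : s ≤ c * Metric.diam O' := by nlinarith
  obtain ⟨α, hα⟩ := hW.exists_superset O' h1 ⟨c * Metric.diam O', h3⟩ rfl
  have hle : (⟨c * Metric.diam O', h3⟩ : Set.Ici s) ≤ ε := by
    change c * Metric.diam O' ≤ ε
    rw [hε]
    exact mul_le_mul_of_nonneg_left h2 (by linarith)
  exact ⟨W.map hle α, (hOO'.trans hα).trans (W.subset_map hle α)⟩

theorem SetTower.IsGood.exists_star_subset {Z : Type*} [MetricSpace Z] [CompactSpace Z]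
    [ConnectedSpace Z] {V : Type*} {K : AbstractSimplicialComplex V} {f : K.Realization → Z}
    {c s : ℝ} {W : SetTower Z s} (hW : W.IsGood c) (hmd : MinimumDiameterCondition K f W)
    {ε ε' : Set.Ici s} (hε : (ε' : ℝ) = 3 * c * ε) (α : W.Idx ε) :
    ∃ β : W.Idx ε', ∀ σ ∈ K.faces, ∀ x ∈ K.closedSimplex σ, f x ∈ W.carrier ε α →
      ∀ y ∈ K.closedSimplex σ, f y ∈ W.carrier ε' β := by
  set d := Metric.diam (W.carrier ε α) with hd
  have hdε : d ≤ ε := hW.diam_le ε α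
  have hεs : s ≤ ε := ε.2
  have hbdd : ∀ S : Set Z, Bornology.IsBounded S := fun S => Metric.isBounded_of_compactSpace
  obtain ⟨z, hz⟩ := (hW.isPathConnected ε α).nonempty
  -- The `d`-neighbourhood of the member depends on no simplex, so one `β` serves all simplices that
  -- meet its preimage; its diameter is at most `3d ≤ 3ε`.
  set O : Set Z := {z | ∃ w ∈ W.carrier ε α, dist z w ≤ d} with hO
  have hdiam : Metric.diam O ≤ 3 * ε := by
    refine Metric.diam_le_of_forall_dist_le (by linarith [hW.pos]) ?_
    rintro x ⟨u, hu, hxu⟩ y ⟨v, hv, hyv⟩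
    have h1 : dist u v ≤ d := Metric.dist_le_diam_of_mem (hbdd _) hu hv
    have h2 := dist_triangle4 x u v y
    rw [dist_comm v y] at h2
    linarith
  have hzO : z ∈ O := ⟨z, hz, by rw [dist_self]; exact Metric.diam_nonneg⟩
  obtain ⟨β, hβ⟩ := hW.exists_subset (ε := ε') ⟨z, hzO⟩ (hbdd _) hdiam (by linarith [hW.pos])
    (by rw [hε]; ring)
  refine ⟨β, fun σ hσ x hx hfx y hy => hβ ⟨f x, hfx, ?_⟩⟩
  refine (Metric.dist_le_diam_of_mem (hbdd _) (Set.mem_image_of_mem f hy)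
    (Set.mem_image_of_mem f hx)).trans
    ((hmd σ hσ).trans ?_)
  refine ciInf_le (f := fun p : Σ ε : Set.Ici s, W.Idx ε => Metric.diam (W.carrier p.1 p.2))
    ⟨0, ?_⟩ ⟨ε, α⟩
  rintro _ ⟨p, rfl⟩
  exact Metric.diam_nonneg

/-! ## Comparison of the two pullbacks -/

/-- The path components of preimages are refined, up to a bounded change of scale, by the
components of the induced subgraphs. -/
theorem SetTower.IsGood.exists_graphPullback {Z : Type*} [MetricSpace Z] [CompactSpace Z]
    [ConnectedSpace Z] {V : Type*} {K : AbstractSimplicialComplex V} {f : K.Realization → Z}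
    {c s : ℝ} {W : SetTower Z s} (hW : W.IsGood c) (hmd : MinimumDiameterCondition K f W)
    {ε ε' : Set.Ici s} (hε : (ε' : ℝ) = 3 * c * ε) (P : (W.pullback f).Idx ε) :
    ∃ Q : (W.graphPullback K.oneSkeletonGraph (fun v => f (K.vertexPoint v))).Idx ε',
      ∀ (x : K.Realization) (v : V), v ∈ x.1.support → x ∈ (W.pullback f).carrier ε P →
        v ∈ (W.graphPullback K.oneSkeletonGraph (fun v => f (K.vertexPoint v))).carrier ε' Q := by
  obtain ⟨α, C⟩ := P
  obtain ⟨β, hβ⟩ := hW.exists_star_subset hmd hε α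
  set H := K.oneSkeletonGraph.induce
    ((fun v => f (K.vertexPoint v)) ⁻¹' W.carrier ε' β) with hH
  have hmem : ∀ x : f ⁻¹' W.carrier ε α, ∀ v ∈ x.1.1.support,
      v ∈ (fun v => f (K.vertexPoint v)) ⁻¹' W.carrier ε' β := fun x v hv =>
    hβ _ (K.support_mem_faces x.1) x.1 (K.mem_closedSimplex_support x.1) x.2 _
      (K.vertexPoint_mem_closedSimplex hv)
  have hconn : ∀ (x : f ⁻¹' W.carrier ε α) (u v : V) (hu : u ∈ x.1.1.support)
      (hv : v ∈ x.1.1.support), H.connectedComponentMk ⟨u, hmem x u hu⟩ =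
        H.connectedComponentMk ⟨v, hmem x v hv⟩ := by
    intro x u v hu hv
    by_cases h : u = v
    · subst h
      rfl
    · refine SimpleGraph.ConnectedComponent.sound (SimpleGraph.Adj.reachable ?_)
      exact K.oneSkeletonGraph_adj (K.support_mem_faces x.1) hu hv h
  choose ν hν using fun x : f ⁻¹' W.carrier ε α => K.support_nonempty x.1
  let comp : f ⁻¹' W.carrier ε α → H.ConnectedComponent := fun x =>
    H.connectedComponentMk ⟨ν x, hmem x _ (hν x)⟩
  -- Near `x` the coordinate at `ν x` stays nonzero, so nearby points have `ν x` in their carriers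
  -- and determine the same component. Hence `comp` is constant along paths.
  have hcomp : IsLocallyConstant comp := by
    refine (IsLocallyConstant.iff_eventually_eq comp).2 fun x => ?_
    have hcont : Continuous fun y : f ⁻¹' W.carrier ε α => y.1.1 (ν x) :=
      (K.continuous_coordinate (ν x)).comp continuous_subtype_val
    filter_upwards [hcont.continuousAt.eventually_ne (Finsupp.mem_support_iff.1 (hν x))] with y hy
    exact hconn y _ _ (hν y) (Finsupp.mem_support_iff.2 hy)
  obtain ⟨x₀, rfl⟩ := ZerothHomotopy.mk_surjective C
  refine ⟨⟨β, comp x₀⟩, ?_⟩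
  rintro x v hv ⟨hx, hxC⟩
  have hjoin : Joined (⟨x, hx⟩ : f ⁻¹' W.carrier ε α) x₀ := Quotient.exact hxC
  have heq : comp ⟨x, hx⟩ = comp x₀ := by
    obtain ⟨γ⟩ := hjoin
    have h := (hcomp.comp_continuous γ.continuous).apply_eq_of_preconnectedSpace 0 1
    simpa using h
  exact ⟨hmem ⟨x, hx⟩ v hv, (hconn ⟨x, hx⟩ _ _ hv (hν _)).trans heq⟩

/-- The components of the induced subgraphs are refined, up to a bounded change of scale, by the
path components of preimages. -/
theorem SetTower.IsGood.exists_pullback {Z : Type*} [MetricSpace Z] [CompactSpace Z]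
    [ConnectedSpace Z] {V : Type*} {K : AbstractSimplicialComplex V} {f : K.Realization → Z}
    {c s : ℝ} {W : SetTower Z s} (hW : W.IsGood c) (hmd : MinimumDiameterCondition K f W)
    {ε ε' : Set.Ici s} (hε : (ε' : ℝ) = 3 * c * ε)
    (Q : (W.graphPullback K.oneSkeletonGraph (fun v => f (K.vertexPoint v))).Idx ε) :
    ∃ P : (W.pullback f).Idx ε', ∀ (x : K.Realization) (v : V), v ∈ x.1.support →
      v ∈ (W.graphPullback K.oneSkeletonGraph (fun v => f (K.vertexPoint v))).carrier ε Q →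
        x ∈ (W.pullback f).carrier ε' P := by
  classical
  obtain ⟨α, C⟩ := Q
  obtain ⟨β, hβ⟩ := hW.exists_star_subset hmd hε α
  have hsub : ∀ σ ∈ K.faces, ∀ v ∈ σ, f (K.vertexPoint v) ∈ W.carrier ε α →
      K.closedSimplex σ ⊆ f ⁻¹' W.carrier ε' β := fun σ hσ v hv hfv y hy =>
    hβ σ hσ _ (K.vertexPoint_mem_closedSimplex hv) hfv y hy
  have hjoin : ∀ σ ∈ K.faces, ∀ v ∈ σ, f (K.vertexPoint v) ∈ W.carrier ε α →
      ∀ x (hx : x ∈ f ⁻¹' W.carrier ε' β) y (hy : y ∈ f ⁻¹' W.carrier ε' β),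
        x ∈ K.closedSimplex σ → y ∈ K.closedSimplex σ →
        ZerothHomotopy.mk (⟨x, hx⟩ : f ⁻¹' W.carrier ε' β) = ZerothHomotopy.mk ⟨y, hy⟩ := by
    intro σ hσ v hv hfv x hx y hy hxσ hyσ
    exact Quotient.sound
      (((K.isPathConnected_closedSimplex hσ).joinedIn x hxσ y hyσ).mono
        (hsub σ hσ v hv hfv)).joined_subtype
  have hmem : ∀ v : (fun v => f (K.vertexPoint v)) ⁻¹' W.carrier ε α,
      K.vertexPoint v ∈ f ⁻¹' W.carrier ε' β := fun v =>
    hsub _ (K.singleton_mem v.1) v.1 (Finset.mem_singleton_self _) v.2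
      (K.vertexPoint_mem_closedSimplex (Finset.mem_singleton_self _))
  -- Each edge of a walk over `W_α` is a closed simplex mapped into the larger member, so it joins
  -- its end points by a path there.
  have hreach : ∀ u v : (fun v => f (K.vertexPoint v)) ⁻¹' W.carrier ε α,
      (K.oneSkeletonGraph.induce _).Reachable u v →
        ZerothHomotopy.mk (⟨K.vertexPoint u, hmem u⟩ : f ⁻¹' W.carrier ε' β) =
          ZerothHomotopy.mk ⟨K.vertexPoint v, hmem v⟩ := by
    rintro u v ⟨w⟩
    induction w with
    | nil => rfl
    | @cons u v w h _ ih =>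
      refine Eq.trans ?_ ih
      have hadj : K.oneSkeletonGraph.Adj u.1 v.1 := h
      refine hjoin _ hadj.2 u.1 (by simp) u.2 _ _ _ _ ?_ ?_ <;>
        exact K.vertexPoint_mem_closedSimplex (by simp)
  induction C using SimpleGraph.ConnectedComponent.ind with | _ v₀ =>
  refine ⟨⟨β, ZerothHomotopy.mk ⟨K.vertexPoint v₀, hmem v₀⟩⟩, ?_⟩
  rintro x v hv ⟨hfv, hvC⟩
  have h1 := hreach _ _ (SimpleGraph.ConnectedComponent.exact hvC)
  have hx : x ∈ f ⁻¹' W.carrier ε' β :=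
    hsub _ (K.support_mem_faces x) v hv hfv (K.mem_closedSimplex_support x)
  refine ⟨hx, Eq.trans ?_ h1⟩
  exact hjoin _ (K.support_mem_faces x) v hv hfv _ _ _ _ (K.mem_closedSimplex_support x)
    (K.vertexPoint_mem_closedSimplex hv)

end MultiscaleMapper

/-! ### The main theorem -/

open MultiscaleMapper in
theorem mainTheorem4 {F : Type*} [Field F]
    {Z : Type*} [MetricSpace Z] [CompactSpace Z] [ConnectedSpace Z]
    {V : Type*} (K : AbstractSimplicialComplex V)
    (f : K.Realization → Z) (hf : Continuous f)
    {c s : ℝ} (W : SetTower Z s) (hW : W.IsGood c)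
    (hfin : (W.pullback f).IsFinite)
    (hfinV : (W.graphPullback K.oneSkeletonGraph (fun v => f (K.vertexPoint v))).IsFinite)
    (hmd : MinimumDiameterCondition K f W) (k : ℕ) :
    bottleneckDist
      (diagram ((multiscaleMapper (W.reindexLog hW.pos) f).homology F k))
      (diagram ((graphMultiscaleMapper (W.reindexLog hW.pos) K.oneSkeletonGraph
        (fun v => f (K.vertexPoint v))).homology F k)) ≤
      ENNReal.ofReal (3 * Real.log (3 * c) + 3 * max 0 (Real.log (1 / s))) := by
  have hc : 0 < 3 * c := by linarith [hW.one_le]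
  have hη : 0 < Real.log (3 * c) := Real.log_pos (by linarith [hW.one_le])
  have hexp : ∀ t, Real.exp (t + Real.log (3 * c)) = 3 * c * Real.exp t := fun t => by
    rw [Real.exp_add, Real.exp_log hc, mul_comm]
  -- The refinements already give the bound `3 * log (3 * c)`; the other summand is nonnegative.
  refine le_trans ?_ (ENNReal.ofReal_le_ofReal
    (le_add_of_nonneg_right (mul_nonneg zero_le_three (le_max_left 0 (Real.log (1 / s))))))
  refine bottleneckDist_le_of_familyAt_le
    (S := (W.reindexLog hW.pos).pullback f)
    (T := (W.reindexLog hW.pos).graphPullback K.oneSkeletonGraph fun v => f (K.vertexPoint v))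
    (fun t => hfin _) (fun t => hfinV _)
    AbstractSimplicialComplex.PointedRealization.point_surjective
    AbstractSimplicialComplex.PointedRealization.vertex_surjective hη ?_ ?_ F k
  · intro t
    by_cases ht : Real.log s ≤ t
    · rw [SetTower.familyAt_of_le _ _ ht, SetTower.familyAt_of_le _ _ (by linarith)]
      intro P
      obtain ⟨Q, hQ⟩ := hW.exists_graphPullback hmd
        (ε := ⟨Real.exp t, (Real.log_le_iff_le_exp hW.pos).1 ht⟩)
        (ε' := ⟨Real.exp (t + Real.log (3 * c)),
          (Real.log_le_iff_le_exp hW.pos).1 (by linarith)⟩) (hexp t) P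
      exact ⟨Q, fun e he => hQ e.point e.vertex e.vertex_mem he⟩
    · rw [SetTower.familyAt_of_not_le _ _ ht]
      exact fun a => a.elim
  · intro t
    by_cases ht : Real.log s ≤ t
    · rw [SetTower.familyAt_of_le _ _ ht, SetTower.familyAt_of_le _ _ (by linarith)]
      intro Q
      obtain ⟨P, hP⟩ := hW.exists_pullback hmd
        (ε := ⟨Real.exp t, (Real.log_le_iff_le_exp hW.pos).1 ht⟩)
        (ε' := ⟨Real.exp (t + Real.log (3 * c)),
          (Real.log_le_iff_le_exp hW.pos).1 (by linarith)⟩) (hexp t) Q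
      exact ⟨P, fun e he => hP e.point e.vertex e.vertex_mem he⟩
    · rw [SetTower.familyAt_of_not_le _ _ ht]
      exact fun a => a.elim
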